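/- **Quaternionic positive real lemma.** Let $\mathbb H$ be the quaternions, $\mathbb H_+=\{p:\operatorname{Re}p>0\}$, and $\mathbb S$ the sphere of imaginary units ($I^2=-1$). A matrix function $f$ is (left) slice hyperholomorphic on an axially symmetric open set if $f(x+Iy)=\alpha(x,y)+I\beta(x,y)$ for $I\in\mathbb S$, with $\alpha$ even and $\beta$ odd in $y$, both real differentiable, and $\partial_x\alpha=\partial_y\beta$, $\partial_y\alpha=-\partial_x\beta$. The $\star$-product of $f=\alpha+I\beta$ and $g=\gamma+I\delta$ is $f\star g=(\alpha\gamma-\beta\delta)+I(\alpha\delta+\beta\gamma)$. For $A\in\mathbb H^{N\times N}$ let $\Omega_A\subseteq\mathbb H$ be the set of points around which $p\mapsto pI_N-A$ has a slice hyperholomorphic two-sided $\star$-inverse $(pI_N-A)^{-\star}$. Let $\phi$ be an $\mathbb H^{n\times n}$-valued rational slice hyperholomorphic function, slice hyperholomorphic at infinity, with realization $$\phi(p)=D+C\star(pI_N-A)^{-\star}\star B,\qquad p\in\Omega_A,$$ where $A\in\mathbb H^{N\times N}$, $B\in\mathbb H^{N\times n}$, $C\in\mathbb H^{n\times N}$,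 $D\in\mathbb H^{n\times n}$. Assume the realization is minimal, that is, $\bigcap_{t\ge0}\ker CA^t=\{0\}$ and $\bigcap_{t\ge0}\ker B^*A^{*t}=\{0\}$. Put $$K_\phi(p,q)=(\phi(p)+\phi(q)^*)\star(p+\overline q)^{-\star},\qquad (p+\overline q)^{-\star}=(|q|^2+2\operatorname{Re}(q)\,p+p^2)^{-1}(p+q),$$ the $\star$-product being taken in $p$. A kernel $K$ is positive definite on a set $\Omega$ if $K(p,q)=K(q,p)^*$ on $\Omega$ and all Hermitian matrices $\big(\xi_k^*K(u_k,u_j)\xi_j\big)_{k,j=1}^m$ with $m\in\mathbb N$, $u_k\in\Omega$, $\xi_k\in\mathbb H^n$ are positive semidefinite. Then the following are equivalent: 1. $\mathbb H_+\subseteq\Omega_A$ and $K_\phi$ is positive definite on $\mathbb H_+$; 2. $K_\phi$ is positive definite on $\mathbb H_+\cap\Omega_A$; 3. there is a negative definite (Hermitian) matrix $H\in\mathbb H^{N\times N}$ such that $$\begin{pmatrix}H&0\\0&I_n\end{pmatrix}\begin{pmatrix}A&B\\C&D\end{pmatrix}+\begin{pmatrix}A&B\\C&D\end{pmatrix}^*\begin{pmatrix}H&0\\0&I_n\end{pmatrix}\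 \ge\ 0.$$ -/

import Mathlib

open scoped Quaternion Matrix

noncomputable section

namespace QuatKYP

/-- The sphere of quaternionic imaginary units: purely imaginary quaternions of norm one
(equivalently, the quaternions with square `-1`). -/
def imagSphere : Set ℍ[ℝ] := {I | I.re = 0 ∧ ‖I‖ = 1}

/-- The point `x + I y`. -/
def slicePoint (I : ℍ[ℝ]) (x y : ℝ) : ℍ[ℝ] := (x : ℍ[ℝ]) + I * (y : ℍ[ℝ])

/-- `Ω` is axially symmetric: with `x + I y` it contains the sphere `{x + J y : J ∈ 𝕊}`. -/
def AxiallySymmetric (Ω : Set ℍ[ℝ]) : Prop :=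
  ∀ x y : ℝ, ∀ I ∈ imagSphere, ∀ J ∈ imagSphere, slicePoint I x y ∈ Ω → slicePoint J x y ∈ Ω

/-- Left slice hyperholomorphic matrix functions on `Ω`:
`f (x + I y) = α (x, y) + I β (x, y)`, where `α` is even in `y`, `β` is odd in `y`, both are
(entrywise) real differentiable and satisfy the Cauchy-Riemann equations at all `(x, y)` with
`x + I y ∈ Ω`. The scalar `I` acts by multiplying all entries from the left. -/
def SliceHyperholomorphicOn {m n : Type*} (f : ℍ[ℝ] → Matrix m n ℍ[ℝ]) (Ω : Set ℍ[ℝ]) : Prop :=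
  ∃ α β : ℝ × ℝ → Matrix m n ℍ[ℝ],
    (∀ x y, α (x, -y) = α (x, y)) ∧ (∀ x y, β (x, -y) = -β (x, y)) ∧
    ∀ x y : ℝ, ∀ I ∈ imagSphere, slicePoint I x y ∈ Ω →
      f (slicePoint I x y) = α (x, y) + I • β (x, y) ∧
      ∀ i j,
        DifferentiableAt ℝ (fun z => α z i j) (x, y) ∧
        DifferentiableAt ℝ (fun z => β z i j) (x, y) ∧
        fderiv ℝ (fun z => α z i j) (x, y) (1, 0) = fderiv ℝ (fun z => β z i j) (x, y) (0, 1) ∧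
        fderiv ℝ (fun z => α z i j) (x, y) (0, 1) = -fderiv ℝ (fun z => β z i j) (x, y) (1, 0)

/-- The quaternion `i`, a reference imaginary unit. -/
def unitI : ℍ[ℝ] := ⟨0, 1, 0, 0⟩

/-- The component `α (x, y)` of a slice function `f (x + I y) = α (x, y) + I β (x, y)`,
recovered from the values of `f` at `x + i y` and `x - i y`. -/
def stemRe {m n : Type*} (f : ℍ[ℝ] → Matrix m n ℍ[ℝ]) (x y : ℝ) : Matrix m n ℍ[ℝ] :=
  (1 / 2 : ℝ) • (f (slicePoint unitI x y) + f (slicePoint unitI x (-y)))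

/-- The component `β (x, y)` of a slice function `f (x + I y) = α (x, y) + I β (x, y)`,
recovered from the values of `f` at `x + i y` and `x - i y`. -/
def stemIm {m n : Type*} (f : ℍ[ℝ] → Matrix m n ℍ[ℝ]) (x y : ℝ) : Matrix m n ℍ[ℝ] :=
  -((1 / 2 : ℝ) • (unitI • (f (slicePoint unitI x y) - f (slicePoint unitI x (-y)))))

theorem unitI_mul_self : unitI * unitI = -1 := by
  have h0 : unitI.re = 0 := rfl
  have h1 : unitI.imI = 1 := rfl
  have h2 : unitI.imJ = 0 := rfl
  have h3 : unitI.imK = 0 := rfl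
  ext <;> simp [h0, h1, h2, h3]

theorem unitI_mem : unitI ∈ imagSphere := by
  refine ⟨rfl, ?_⟩
  have h : ‖unitI‖ * ‖unitI‖ = 1 := by
    rw [← Quaternion.normSq_eq_norm_mul_self, Quaternion.normSq_def']
    simp [unitI]
  nlinarith [norm_nonneg unitI]

/-- On a slice hyperholomorphic function, `stemRe` and `stemIm` are the components in its
defining decomposition. -/
theorem stem_eq {m n : Type*} {f : ℍ[ℝ] → Matrix m n ℍ[ℝ]} {α β : ℝ × ℝ → Matrix m n ℍ[ℝ]}
    {x y : ℝ} (hα : α (x, -y) = α (x, y)) (hβ : β (x, -y) = -β (x, y))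
    (h1 : f (slicePoint unitI x y) = α (x, y) + unitI • β (x, y))
    (h2 : f (slicePoint unitI x (-y)) = α (x, -y) + unitI • β (x, -y)) :
    stemRe f x y = α (x, y) ∧ stemIm f x y = β (x, y) := by
  rw [hα, hβ] at h2
  constructor
  · rw [stemRe, h1, h2, smul_neg, add_add_add_comm, add_neg_cancel, add_zero, ← two_smul ℝ,
      smul_smul]
    norm_num
  · have h : α (x, y) + unitI • β (x, y) - (α (x, y) + unitI • (-β (x, y)))
        = (2 : ℝ) • (unitI • β (x, y)) := by
      rw [smul_neg, two_smul]; abel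
    rw [stemIm, h1, h2, h, smul_comm unitI (2 : ℝ), smul_smul, smul_smul, unitI_mul_self]
    norm_num

/-- The imaginary unit `I` of a nonreal quaternion `p = x + I y`, `y > 0` (and `0` at real `p`,
where the component it multiplies vanishes). -/
def sliceUnit (p : ℍ[ℝ]) : ℍ[ℝ] := (‖p.im‖⁻¹ : ℝ) • p.im

/-- The `⋆`-product of slice functions: for `f = α + I β` and `g = γ + I δ`,
`f ⋆ g = (α γ - β δ) + I (α δ + β γ)`. -/
def starMul {l m n : Type*} [Fintype m] (f : ℍ[ℝ] → Matrix l m ℍ[ℝ])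
    (g : ℍ[ℝ] → Matrix m n ℍ[ℝ]) (p : ℍ[ℝ]) : Matrix l n ℍ[ℝ] :=
  let x := p.re
  let y := ‖p.im‖
  (stemRe f x y * stemRe g x y - stemIm f x y * stemIm g x y) +
    sliceUnit p • (stemRe f x y * stemIm g x y + stemIm f x y * stemRe g x y)

/-- `g` is the `⋆`-inverse of `f` on `Ω`. -/
structure IsStarInverseOn {m : Type*} [Fintype m] [DecidableEq m]
    (f g : ℍ[ℝ] → Matrix m m ℍ[ℝ]) (Ω : Set ℍ[ℝ]) : Prop where
  slice : SliceHyperholomorphicOn g Ω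
  mul_inv : ∀ p ∈ Ω, starMul f g p = 1
  inv_mul : ∀ p ∈ Ω, starMul g f p = 1

/-- The function `p ↦ p I - A`. -/
def pencil {m : Type*} [DecidableEq m] (A : Matrix m m ℍ[ℝ]) (p : ℍ[ℝ]) : Matrix m m ℍ[ℝ] :=
  p • (1 : Matrix m m ℍ[ℝ]) - A

/-- The set of points around which `p I - A` is `⋆`-invertible. -/
def starResolventSet {m : Type*} [Fintype m] [DecidableEq m] (A : Matrix m m ℍ[ℝ]) :
    Set ℍ[ℝ] :=
  {p | ∃ Ω : Set ℍ[ℝ], IsOpen Ω ∧ AxiallySymmetric Ω ∧ p ∈ Ω ∧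
    ∃ R, IsStarInverseOn (pencil A) R Ω}

/-- `φ (p) = D + C ⋆ (p I - A)^{-⋆} ⋆ B`, for all `p` at which the right side is defined. -/
def IsRealization {N n k : Type*} [Fintype N] [DecidableEq N]
    (φ : ℍ[ℝ] → Matrix n k ℍ[ℝ]) (A : Matrix N N ℍ[ℝ]) (B : Matrix N k ℍ[ℝ])
    (C : Matrix n N ℍ[ℝ]) (D : Matrix n k ℍ[ℝ]) : Prop :=
  ∃ R, IsStarInverseOn (pencil A) R (starResolventSet A) ∧
    ∀ p ∈ starResolventSet A,
      φ p = D + starMul (starMul (fun _ => C) R) (fun _ => B) p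

/-- Minimality of `(C, A, B)`: `(C, A)` is observable and `(A, B)` is controllable. -/
structure IsMinimal {N n k : Type*} [Fintype N] [DecidableEq N]
    (C : Matrix n N ℍ[ℝ]) (A : Matrix N N ℍ[ℝ]) (B : Matrix N k ℍ[ℝ]) : Prop where
  observable : ∀ v : N → ℍ[ℝ], (∀ t : ℕ, (C * A ^ t) *ᵥ v = 0) → v = 0
  controllable : ∀ v : N → ℍ[ℝ], (∀ t : ℕ, (Bᴴ * Aᴴ ^ t) *ᵥ v = 0) → v = 0

/-- `M ≥ 0`: `M` is Hermitian and `v^* M v`, which is then real, is nonnegative for all `v`. -/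
def PosSemidef {m : Type*} [Fintype m] (M : Matrix m m ℍ[ℝ]) : Prop :=
  M.IsHermitian ∧ ∀ v : m → ℍ[ℝ], 0 ≤ (star v ⬝ᵥ (M *ᵥ v)).re

/-- `M < 0`: `M` is Hermitian and `v^* M v`, which is then real, is negative for all `v ≠ 0`. -/
def NegDef {m : Type*} [Fintype m] (M : Matrix m m ℍ[ℝ]) : Prop :=
  M.IsHermitian ∧ ∀ v : m → ℍ[ℝ], v ≠ 0 → (star v ⬝ᵥ (M *ᵥ v)).re < 0

/-- The kernel `K` is positive definite on `Ω`: it is Hermitian there, and all the Hermitian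
matrices with entries `ξ_k^* K(u_k, u_j) ξ_j`, `u_k ∈ Ω`, are positive semidefinite. -/
def PosDefKernelOn {n : Type*} [Fintype n] (K : ℍ[ℝ] → ℍ[ℝ] → Matrix n n ℍ[ℝ])
    (Ω : Set ℍ[ℝ]) : Prop :=
  (∀ p ∈ Ω, ∀ q ∈ Ω, K p q = (K q p)ᴴ) ∧
  ∀ (m : ℕ) (u : Fin m → ℍ[ℝ]) (ξ : Fin m → n → ℍ[ℝ]), (∀ k, u k ∈ Ω) →
    PosSemidef (Matrix.of fun k j => star (ξ k) ⬝ᵥ (K (u k) (u j) *ᵥ ξ j))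

/-- `(p + q̄)^{-⋆} = (|q|² + 2 Re(q) p + p²)⁻¹ (p + q)`, the `⋆`-inverse in the variable `p`. -/
def addConjStarInv (q p : ℍ[ℝ]) : ℍ[ℝ] :=
  (((‖q‖ ^ 2 : ℝ) : ℍ[ℝ]) + ((2 * q.re : ℝ) : ℍ[ℝ]) * p + p ^ 2)⁻¹ * (p + q)

/-- The kernel `K_φ(p, q) = (φ(p) + φ(q)^*) ⋆ (p + q̄)^{-⋆}`, with the `⋆`-product taken in `p`.
The scalar function `(p + q̄)^{-⋆}` enters as a multiple of the identity matrix. -/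
def kernel {n : Type*} [Fintype n] [DecidableEq n] (φ : ℍ[ℝ] → Matrix n n ℍ[ℝ])
    (p q : ℍ[ℝ]) : Matrix n n ℍ[ℝ] :=
  starMul (fun p' => φ p' + (φ q)ᴴ)
    (fun p' => addConjStarInv q p' • (1 : Matrix n n ℍ[ℝ])) p

/-- The open half-space of quaternions with positive real part. -/
def halfSpace : Set ℍ[ℝ] := {p | 0 < p.re}

end QuatKYP

end

/-!
Multiplication by a quaternion from the left and by a constant matrix from the right are pointwise
operations on left slice functions. Hence the slice function `G = C ⋆ (p - A)^{-⋆}` satisfies the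
Sylvester equation `p G(p) - G(p) A = C`, the realization reads `φ(p) = D + G(p) B`, and for
`p, q` in the half-space `K_φ(p, q)` is the only solution of `p K + K q̄ = φ(p) + φ(q)^*`
(`IsRealization.exists_sylvester`, `kernel_sylvester`). After this reduction, slice functions are
needed only to produce points of `Ω_A`. Everything else is real linear algebra in the real Hilbert
spaces `ℍⁿ` and `ℍᴺ`, on which a quaternionic matrix acts through `vecMap`. In these terms the
third condition says that `P = -H` is positive definite and that
`⟪P (A x + B u), x⟫ ≤ ⟪C x + D u, u⟫` for all `x` and `u` (`posSemidef_lyapunov_iff`).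

*From the matrix inequality to the kernel.* Taking `u = 0` gives `⟪P A x, x⟫ ≤ 0`, which makes
`(x - A)² + y²` injective for `x > 0` (`isUnit_spherePoly_of_dissipative`); the star resolvent can
then be written down (`isStarInverseOn_starResolvent`), so that `ℍ₊ ⊆ Ω_A`. For points
`u₁, …, u_m` of `ℍ₊`, let `T` be the Gram operator of `K_φ` minus that of the positive kernel
`G(p) P⁻¹ G(q)^*`. With `M = diag(ū_i)`, the matrix inequality says that `T M + M^* T ≥ 0`. As `M`
has positive definite real part, this forces `T ≥ 0` (`inner_nonneg_of_lyapunov`,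
`kernel_nonneg_of_dissipative`).

*From the kernel to the matrix inequality.* Let `𝓗` be the reproducing kernel Hilbert space of
`K_φ` on `ℍ₊ ∩ Ω_A`. The Sylvester equation makes a Cayley transform, taken at a real point `a`,
isometric on linear combinations of kernel functions, and so yields a contraction `J` of `𝓗`
(`exists_contraction`). Its adjoint acts on the functions `G(·) x` as a Cayley transform of `A`, so
by controllability all of them lie in `𝓗`, and that `J` is a contraction translates into
`⟪V (A x + B u), V x⟫ ≤ ⟪C x + D u, u⟫` for `V x = G(·) x` (`exists_storage`). By observability `V`
is injective (`eq_zero_of_observable`), so `⟪V x, V y⟫` is a positive definite real form. It need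
not come from a quaternionic matrix, but its average over right multiplication by `1, i, j, k` does
(`exists_matrix_of_average`), and the inequality survives averaging because `A`, `B`, `C`, `D`
commute with right multiplication (`exists_negDef_of_storage`).
-/

namespace QuatKYP

open scoped InnerProductSpace
open RKHS Filter Topology

/-! ### A contraction of the reproducing kernel Hilbert space -/

section Colligation

variable {ι U H : Type*} [NormedAddCommGroup U] [InnerProductSpace ℝ U] [CompleteSpace U]
  [NormedAddCommGroup H] [InnerProductSpace ℝ H] [CompleteSpace H] [RKHS ℝ H ι U]

/-- Let `K` be the kernel of `H`, with the operators `L q` in the role of `q̄`, so that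
`p K(p, q) + K(p, q) q̄ = φ(p) + φ(q)^*`. Then the Cayley transform
`K(·, q) (q̄ - a) c ↦ K(·, q) (q̄ + a) c - 2 a K(·, o) c`, where `o` is the point `a`, preserves
inner products; it extends to a contraction because its domain is dense. The operator `q̄ - a` is
invertible for `q ≠ o` only; `hcl` recovers the kernel functions at `o`. -/
theorem exists_contraction (L : ι → U →ₗ[ℝ] U) (φ : ι → U →ₗ[ℝ] U) (o : ι) (a : ℝ)
    (ho : ∀ c, L o c = a • c)
    (hK : ∀ p q c d, ⟪kerFun H q (L q c), kerFun H p d⟫_ℝ + ⟪kerFun H q c, kerFun H p (L p d)⟫_ℝ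
      = ⟪φ p c, d⟫_ℝ + ⟪c, φ q d⟫_ℝ)
    (hL : ∀ q, q ≠ o → ∀ c, ∃ d, L q d - a • d = c)
    (hcl : ∀ c, kerFun H o c ∈ closure {h | ∃ q, q ≠ o ∧ kerFun H q c = h}) :
    ∃ J : H →L[ℝ] H, (∀ h, ‖J h‖ ≤ ‖h‖) ∧
      ∀ q c, J (kerFun H q (L q c - a • c)) =
        kerFun H q (L q c + a • c) - (2 * a) • kerFun H o c := by
  let e : (ι →₀ U) →ₗ[ℝ] H := Finsupp.lsum ℝ fun q =>
    (kerFun H q).toLinearMap ∘ₗ (L q - a • LinearMap.id)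
  let f : (ι →₀ U) →ₗ[ℝ] H := Finsupp.lsum ℝ fun q =>
    (kerFun H q).toLinearMap ∘ₗ (L q + a • LinearMap.id) - (2 * a) • (kerFun H o).toLinearMap
  have he : ∀ q c, e (Finsupp.single q c) = kerFun H q (L q c - a • c) := fun q c => by
    simp [e]
  have hf : ∀ q c, f (Finsupp.single q c) =
      kerFun H q (L q c + a • c) - (2 * a) • kerFun H o c := fun q c => by
    simp [f]
  have hsingle : ∀ q c p d, ⟪f (Finsupp.single q c), f (Finsupp.single p d)⟫_ℝ
      = ⟪e (Finsupp.single q c), e (Finsupp.single p d)⟫_ℝ := by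
    intro q c p d
    have h1 := hK p q c d
    have h2 := hK o q c d
    have h3 := hK p o c d
    have h4 := hK o o c d
    rw [ho, map_smul, inner_smul_right] at h2
    rw [ho, map_smul, inner_smul_left] at h3
    rw [ho, ho, map_smul, map_smul, inner_smul_left, inner_smul_right] at h4
    simp only [he, hf, map_add, map_sub, map_smul, inner_add_left, inner_add_right,
      inner_sub_left, inner_sub_right, inner_smul_left, inner_smul_right, RCLike.conj_to_real]
      at h1 h2 h3 h4 ⊢
    linear_combination (2 * a) * (h1 - h2 - h3 + h4)
  -- `f` and `e` have equal Gram forms, so `e c ↦ f c` is well defined and isometric.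
  have hform : (innerₗ H).compl₁₂ f f = (innerₗ H).compl₁₂ e e := by
    refine Finsupp.lhom_ext' fun q => LinearMap.ext fun c => Finsupp.lhom_ext' fun p =>
      LinearMap.ext fun d => ?_
    exact hsingle q c p d
  have hnorm : ∀ c, ‖f c‖ ≤ 1 * ‖e c‖ := by
    intro c
    have h := LinearMap.congr_fun (LinearMap.congr_fun hform c) c
    simp only [LinearMap.compl₁₂_apply, innerₗ_apply_apply, real_inner_self_eq_norm_sq] at h
    rw [one_mul]
    exact le_of_eq ((sq_eq_sq₀ (norm_nonneg _) (norm_nonneg _)).1 h)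
  have hdense : DenseRange e := by
    have hne : ∀ q, q ≠ o → ∀ c, kerFun H q c ∈ LinearMap.range e := by
      intro q hq c
      obtain ⟨d, rfl⟩ := hL q hq c
      exact ⟨Finsupp.single q d, he q d⟩
    have hall : ∀ q c, kerFun H q c ∈ (LinearMap.range e).topologicalClosure := by
      intro q c
      by_cases hq : q = o
      · subst hq
        refine closure_mono ?_ (hcl c)
        rintro h ⟨p, hp, rfl⟩
        exact hne p hp c
      · exact subset_closure (hne q hq c)
    have htop : (LinearMap.range e).topologicalClosure = ⊤ := by
      rw [eq_top_iff, ← kerFun_dense H]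
      refine Submodule.topologicalClosure_minimal _ (Submodule.span_le.2 ?_)
        (Submodule.isClosed_topologicalClosure _)
      rintro _ ⟨q, c, rfl⟩
      exact hall q c
    rw [DenseRange, ← LinearMap.coe_range, Submodule.dense_iff_topologicalClosure_eq_top]
    exact htop
  refine ⟨f.extendOfNorm e, fun h => ?_, fun q c => ?_⟩
  · simpa using LinearMap.norm_extendOfNorm_apply_le (f := f) (e := e) hdense 1 hnorm h
  · rw [← he, LinearMap.extendOfNorm_eq hdense ⟨1, hnorm⟩, hf]

end Colligation

/-! ### The storage function -/

section Storage

variable {ι U H X : Type*} [NormedAddCommGroup U] [InnerProductSpace ℝ U] [CompleteSpace U]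
  [NormedAddCommGroup H] [InnerProductSpace ℝ H] [CompleteSpace H] [RKHS ℝ H ι U]
  [AddCommGroup X] [Module ℝ X]

/-- In the setting of `exists_contraction`, let `φ(q) = D + G(q) B` with `q G(q) - G(q) A = C`,
and let `R = (a - A)⁻¹` generate the state space from the range of `R B`. Then all functions
`q ↦ G(q) x` lie in `H`, and their squared norm is a storage function for `(A, B, C, D)`. The
hypotheses on `s` express continuity at the point `o = a`, where `q̄ - a` is not invertible. -/
theorem exists_storage (L φ : ι → U →ₗ[ℝ] U) (o : ι) (a : ℝ) (ha : 0 < a)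
    (ho : ∀ c, L o c = a • c)
    (hK : ∀ p q c d, ⟪kerFun H q (L q c), kerFun H p d⟫_ℝ + ⟪kerFun H q c, kerFun H p (L p d)⟫_ℝ
      = ⟪φ p c, d⟫_ℝ + ⟪c, φ q d⟫_ℝ)
    (hL : ∀ q, q ≠ o → ∀ c, ∃ d, L q d - a • d = c)
    (A R : X →ₗ[ℝ] X) (B : U →ₗ[ℝ] X) (C : X →ₗ[ℝ] U) (D : U →ₗ[ℝ] U) (G : ι → X →ₗ[ℝ] U)
    (hG : ∀ q x c, ⟪G q x, L q c⟫_ℝ - ⟪G q (A x), c⟫_ℝ = ⟪C x, c⟫_ℝ)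
    (hφ : ∀ q u, φ q u = D u + G q (B u))
    (hR : ∀ x, a • R x - A (R x) = x) (hR' : ∀ x, R (a • x - A x) = x)
    (hreach : ∀ S : Submodule ℝ X, (∀ u, R (B u) ∈ S) → (∀ x ∈ S, R x ∈ S) → S = ⊤)
    (s : ℕ → ι) (hs : ∀ m, s m ≠ o)
    (hsK : ∀ c, Tendsto (fun m => kerFun H (s m) c) atTop (𝓝 (kerFun H o c)))
    (hsG : ∀ x, Tendsto (fun m => G (s m) x) atTop (𝓝 (G o x))) :
    ∃ V : X →ₗ[ℝ] H, (∀ x q, V x q = G q x) ∧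
      ∀ x u, ⟪V (A x + B u), V x⟫_ℝ ≤ ⟪C x + D u, u⟫_ℝ := by
  obtain ⟨J, hJn, hJ⟩ := exists_contraction L φ o a ho hK hL fun c =>
    mem_closure_of_tendsto (hsK c) (Eventually.of_forall fun m => ⟨s m, hs m, rfl⟩)
  -- The values of `v` at `q ≠ o` are tested against all vectors, since `L q - a` is surjective;
  -- the value at `o` is then determined by continuity.
  have key : ∀ (v : H) (x : X), (∀ q c, ⟪v, kerFun H q (L q c - a • c)⟫_ℝ
      = ⟪G q x, L q c - a • c⟫_ℝ) → ∀ q, v q = G q x := by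
    intro v x h
    have hne : ∀ q, q ≠ o → v q = G q x := by
      intro q hq
      refine ext_inner_right ℝ fun c => ?_
      obtain ⟨d, rfl⟩ := hL q hq c
      rw [← h, inner_kerFun]
    intro q
    by_cases hq : q = o
    · subst hq
      refine ext_inner_right ℝ fun c => ?_
      have h1 := (tendsto_const_nhds (x := v)).inner (𝕜 := ℝ) (hsK c)
      have h2 := (hsG x).inner (𝕜 := ℝ) (tendsto_const_nhds (x := c))
      simp only [inner_kerFun, hne _ (hs _)] at h1
      exact tendsto_nhds_unique h1 h2
    · exact hne q hq
  have hGA : ∀ q x c, ⟪G q x, L q c - a • c⟫_ℝ = ⟪C x, c⟫_ℝ - ⟪G q (a • x - A x), c⟫_ℝ := by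
    intro q x c
    rw [← hG q x c, inner_sub_right, map_sub, map_smul, inner_sub_left, inner_smul_right,
      inner_smul_left]
    simp
  have hCo : ∀ x, C x = G o (a • x - A x) := by
    intro x
    refine ext_inner_right ℝ fun c => ?_
    have h := hGA o x c
    rw [ho, sub_self, inner_zero_right] at h
    linarith
  -- In both cases the function `q ↦ G q x` is found in `H` from the values of `J.adjoint`.
  have hB : ∀ u q, (-(J.adjoint (kerFun H o u))) q = G q (R (B u)) := by
    intro u
    refine key _ _ fun q c => ?_
    have h1 := hK q o u c
    have h2 := hK o o u c
    rw [ho, map_smul, inner_smul_left] at h1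
    rw [ho, ho, map_smul, map_smul, inner_smul_left, inner_smul_right] at h2
    rw [hGA, hCo, hR, inner_neg_left, ContinuousLinearMap.adjoint_inner_left, hJ, inner_sub_right,
      map_add, map_smul, inner_add_right, inner_smul_right, inner_smul_right]
    rw [hφ q] at h1
    rw [hφ o u] at h2
    rw [inner_add_left] at h1 h2
    simp only [RCLike.conj_to_real] at h1 h2
    linarith
  have hRS : ∀ x (v : H), (∀ q, v q = G q x) →
      ∀ q, ((1 / (2 * a)) • (v - J.adjoint v)) q = G q (R x) := by
    intro x v hv
    refine key _ _ fun q c => ?_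
    rw [hGA, hCo, hR, inner_smul_left, inner_sub_left, ContinuousLinearMap.adjoint_inner_left, hJ,
      inner_sub_right, inner_smul_right, inner_kerFun, inner_kerFun, inner_kerFun, hv, hv,
      inner_sub_right, inner_add_right, inner_smul_right, RCLike.conj_to_real]
    field_simp
    ring
  have hex : ∀ x, ∃ v : H, ∀ q, v q = G q x := by
    let S : Submodule ℝ X :=
      { carrier := {x | ∃ v : H, ∀ q, v q = G q x}
        add_mem' := by
          rintro x y ⟨v, hv⟩ ⟨w, hw⟩
          exact ⟨v + w, fun q => by simp [hv, hw]⟩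
        zero_mem' := ⟨0, fun q => by simp⟩
        smul_mem' := by
          rintro r x ⟨v, hv⟩
          exact ⟨r • v, fun q => by simp [hv]⟩ }
    have hS : S = ⊤ := hreach S (fun u => ⟨_, hB u⟩) (fun x ⟨v, hv⟩ => ⟨_, hRS x v hv⟩)
    intro x
    have : x ∈ S := hS ▸ Submodule.mem_top
    exact this
  choose v hv using hex
  let V : X →ₗ[ℝ] H :=
    { toFun := v
      map_add' := fun x y => RKHS.ext fun q => by simp [hv]
      map_smul' := fun r x => RKHS.ext fun q => by simp [hv] }
  have hV : ∀ x q, V x q = G q x := hv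
  refine ⟨V, hV, fun x u => ?_⟩
  -- In terms of `z = a x - A x - B u`, dissipativity is the contractivity of `J`.
  obtain ⟨z, hz⟩ : ∃ z, z = a • x - A x - B u := ⟨_, rfl⟩
  have hxz : x = R z + R (B u) := by rw [← map_add, hz, sub_add_cancel, hR']
  have hVx : (2 * a) • V x = V z - J.adjoint (V z + (2 * a) • kerFun H o u) := by
    refine RKHS.ext fun q => ?_
    have h1 := hB u q
    have h2 := hRS z (V z) (hV z) q
    rw [coe_neg, Pi.neg_apply] at h1
    rw [coe_smul, Pi.smul_apply] at h2
    rw [coe_smul, Pi.smul_apply, hV, hxz, map_add, ← h1, ← h2, smul_add, smul_smul,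
      mul_one_div_cancel (by positivity), one_smul, map_add, map_smul]
    simp only [coe_sub, coe_add, coe_smul, Pi.sub_apply, Pi.add_apply, Pi.smul_apply, smul_neg]
    abel
  have hVA : V (A x + B u) = a • V x - V z := by
    rw [← map_smul, ← map_sub, hz]; congr 1; abel
  have hn : ‖J.adjoint (V z + (2 * a) • kerFun H o u)‖ ≤ ‖V z + (2 * a) • kerFun H o u‖ := by
    have hJ1 : ‖J.adjoint‖ ≤ 1 := by
      rw [LinearIsometryEquiv.norm_map]
      exact J.opNorm_le_bound zero_le_one fun h => by simpa using hJn h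
    simpa using J.adjoint.le_of_opNorm_le hJ1 (V z + (2 * a) • kerFun H o u)
  have hn2 := pow_le_pow_left₀ (norm_nonneg _) hn 2
  set j := J.adjoint (V z + (2 * a) • kerFun H o u)
  have hCD : C x + D u = G o z + φ o u := by
    rw [hCo, hφ, hz, map_sub (G o) (a • x - A x)]; abel
  have hoo : a * ⟪kerFun H o u, kerFun H o u⟫_ℝ = ⟪φ o u, u⟫_ℝ := by
    have h2 := hK o o u u
    rw [ho, map_smul, inner_smul_left, inner_smul_right, real_inner_comm (φ o u) u] at h2
    simp only [RCLike.conj_to_real] at h2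
    linarith
  have hVz : ⟪V z, kerFun H o u⟫_ℝ = ⟪G o z, u⟫_ℝ := by rw [inner_kerFun, hV]
  have hx2 : V x = (1 / (2 * a)) • (V z - j) := by
    rw [← hVx, smul_smul, one_div_mul_cancel (by positivity), one_smul]
  rw [hCD, hVA, inner_add_left, ← hoo, ← hVz, hx2]
  rw [← real_inner_self_eq_norm_sq, ← real_inner_self_eq_norm_sq] at hn2
  simp only [inner_add_left, inner_add_right, inner_sub_left, inner_sub_right, inner_smul_left,
    inner_smul_right, RCLike.conj_to_real, real_inner_comm (V z) (kerFun H o u),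
    real_inner_comm (V z) j] at hn2 ⊢
  rw [← sub_nonneg] at hn2 ⊢
  have : 0 ≤ (1 / (4 * a)) * _ := mul_nonneg (by positivity) hn2
  -- The right side minus the left side is `(‖h‖² - ‖J.adjoint h‖²) / (4 a)`, with
  -- `h = V z + 2 a K(·, o) u`.
  refine this.trans_eq ?_
  field_simp
  ring

end Storage

/-! ### Positivity from a Lyapunov inequality -/

section Lyapunov

/-- If `M` has positive definite real part and `T` is symmetric with `T M + M^* T ≥ 0`, then
`T ≥ 0`: test the inequality on the eigenvectors of `T`. -/
theorem inner_nonneg_of_lyapunov {E : Type*} [NormedAddCommGroup E] [InnerProductSpace ℝ E]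
    [FiniteDimensional ℝ E] {T M : E →ₗ[ℝ] E} (hT : T.IsSymmetric)
    (hM : ∀ v, v ≠ 0 → 0 < ⟪M v, v⟫_ℝ) (h : ∀ v, 0 ≤ ⟪T v, M v⟫_ℝ) (v : E) :
    0 ≤ ⟪T v, v⟫_ℝ := by
  have hev : ∀ i, 0 ≤ hT.eigenvalues rfl i := by
    intro i
    have h1 := h (hT.eigenvectorBasis rfl i)
    rw [hT.apply_eigenvectorBasis, inner_smul_left, real_inner_comm] at h1
    exact nonneg_of_mul_nonneg_left h1 (hM _ ((hT.eigenvectorBasis rfl).orthonormal.ne_zero i))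
  rw [← (hT.eigenvectorBasis rfl).sum_inner_mul_inner]
  refine Finset.sum_nonneg fun i _ => ?_
  rw [hT, hT.apply_eigenvectorBasis, inner_smul_right, mul_assoc, real_inner_comm]
  exact mul_nonneg (hev i) (mul_self_nonneg _)

/-- Let `k i j` solve `u_i k + k ū_j = φ_i + φ_j^*`, with `L i` in the role of `ū_i`, let
`φ_i = D + G_i B` and `u_i G_i - G_i A = C`, and let `Q` be the inverse of a storage operator of
`(A, B, C, D)`, whose dissipation inequality at `x = -Q z` is `hdiss`. Then `k` is positive: already
`k i j - G_i Q G_j^*` is, by `inner_nonneg_of_lyapunov`. -/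
theorem kernel_nonneg_of_dissipative {κ U X : Type*} [Fintype κ]
    [NormedAddCommGroup U] [InnerProductSpace ℝ U] [FiniteDimensional ℝ U]
    [NormedAddCommGroup X] [InnerProductSpace ℝ X]
    (k : κ → κ → U →ₗ[ℝ] U) (L φ : κ → U →ₗ[ℝ] U)
    (hsymm : ∀ i j c d, ⟪k i j c, d⟫_ℝ = ⟪c, k j i d⟫_ℝ)
    (hk : ∀ i j c d, ⟪k i j c, L i d⟫_ℝ + ⟪k i j (L j c), d⟫_ℝ = ⟪φ i c, d⟫_ℝ + ⟪c, φ j d⟫_ℝ)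
    (hL : ∀ i c, c ≠ 0 → 0 < ⟪L i c, c⟫_ℝ)
    (A Q : X →ₗ[ℝ] X) (B : U →ₗ[ℝ] X) (C : X →ₗ[ℝ] U) (D : U →ₗ[ℝ] U)
    (G : κ → X →ₗ[ℝ] U) (G' : κ → U →ₗ[ℝ] X)
    (hG' : ∀ i x c, ⟪G i x, c⟫_ℝ = ⟪x, G' i c⟫_ℝ)
    (hG : ∀ q x c, ⟪G q x, L q c⟫_ℝ - ⟪G q (A x), c⟫_ℝ = ⟪C x, c⟫_ℝ)
    (hφ : ∀ q u, φ q u = D u + G q (B u))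
    (hQ : Q.IsSymmetric) (hQ0 : ∀ x, 0 ≤ ⟪Q x, x⟫_ℝ)
    (hdiss : ∀ z u, ⟪A (Q z), z⟫_ℝ - ⟪B u, z⟫_ℝ + ⟪C (Q z), u⟫_ℝ - ⟪D u, u⟫_ℝ ≤ 0)
    (c : κ → U) : 0 ≤ ∑ i, ∑ j, ⟪k i j (c j), c i⟫_ℝ := by
  let T : PiLp 2 (fun _ : κ => U) →ₗ[ℝ] PiLp 2 (fun _ : κ => U) :=
    { toFun := fun η => WithLp.toLp 2 fun i => ∑ j, (k i j (η j) - G i (Q (G' j (η j))))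
      map_add' := fun η ζ => by
        ext i; simp [Finset.sum_add_distrib]; abel
      map_smul' := fun r η => by ext i; simp [Finset.smul_sum, smul_sub] }
  let M : PiLp 2 (fun _ : κ => U) →ₗ[ℝ] PiLp 2 (fun _ : κ => U) :=
    { toFun := fun η => WithLp.toLp 2 fun i => L i (η i)
      map_add' := fun η ζ => by ext i; simp
      map_smul' := fun r η => by ext i; simp }
  have hTη : ∀ η ζ : PiLp 2 (fun _ : κ => U), ⟪T η, ζ⟫_ℝ =
      ∑ i, ∑ j, ⟪k i j (η j), ζ i⟫_ℝ - ⟪Q (∑ i, G' i (η i)), ∑ i, G' i (ζ i)⟫_ℝ := by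
    intro η ζ
    rw [PiLp.inner_apply, inner_sum, ← Finset.sum_sub_distrib]
    refine Finset.sum_congr rfl fun i _ => ?_
    rw [← hG', map_sum, map_sum, sum_inner, ← Finset.sum_sub_distrib]
    change ⟪∑ j, _, _⟫_ℝ = _
    rw [sum_inner]
    exact Finset.sum_congr rfl fun j _ => by rw [inner_sub_left]
  have hTs : T.IsSymmetric := by
    intro η ζ
    rw [real_inner_comm (T ζ) η, hTη, hTη, hQ, real_inner_comm (Q (∑ i, G' i (ζ i)))]
    congr 1
    rw [Finset.sum_comm]
    exact Finset.sum_congr rfl fun i _ => Finset.sum_congr rfl fun j _ => by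
      rw [hsymm, real_inner_comm]
  have hMpos : ∀ η, η ≠ 0 → 0 < ⟪M η, η⟫_ℝ := by
    intro η hη
    obtain ⟨i, hi⟩ : ∃ i, η i ≠ 0 := by
      by_contra! h0
      exact hη (by ext i; simpa using h0 i)
    rw [PiLp.inner_apply]
    refine Finset.sum_pos' (fun j _ => ?_) ⟨i, Finset.mem_univ _, hL i _ hi⟩
    by_cases hj : η j = 0
    · simp [hj]
    · exact (hL j _ hj).le
  have hTM : ∀ η, 0 ≤ ⟪T η, M η⟫_ℝ := by
    intro η
    obtain ⟨u, hu⟩ : ∃ u, u = ∑ i, η i := ⟨_, rfl⟩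
    obtain ⟨z, hz⟩ : ∃ z, z = ∑ i, G' i (η i) := ⟨_, rfl⟩
    have h1 : ⟪Q z, ∑ i, G' i (L i (η i))⟫_ℝ = ⟪A (Q z), z⟫_ℝ + ⟪C (Q z), u⟫_ℝ := by
      rw [inner_sum]
      nth_rw 3 [hz]
      rw [hu, inner_sum, inner_sum, ← Finset.sum_add_distrib]
      refine Finset.sum_congr rfl fun i _ => ?_
      rw [← hG', ← hG', ← hG i]; ring
    have h2 : ∑ i, ∑ j, ⟪k i j (η j), L i (η i)⟫_ℝ = ∑ i, ∑ j, ⟪k i j (L j (η j)), η i⟫_ℝ := by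
      rw [Finset.sum_comm]
      exact Finset.sum_congr rfl fun i _ => Finset.sum_congr rfl fun j _ => by
        rw [hsymm, real_inner_comm]
    have h3 : ∑ i, ∑ j, ⟪φ i (η j), η i⟫_ℝ = ⟪D u, u⟫_ℝ + ⟪B u, z⟫_ℝ := by
      have : ∀ i, ∑ j, ⟪φ i (η j), η i⟫_ℝ = ⟪D u, η i⟫_ℝ + ⟪B u, G' i (η i)⟫_ℝ := by
        intro i
        rw [← sum_inner, ← map_sum, ← hu, hφ, inner_add_left, hG']
      rw [Finset.sum_congr rfl fun i _ => this i, Finset.sum_add_distrib, ← inner_sum,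
        ← inner_sum, ← hu, ← hz]
    have h4 : ∑ i, ∑ j, ⟪k i j (η j), L i (η i)⟫_ℝ + ∑ i, ∑ j, ⟪k i j (L j (η j)), η i⟫_ℝ
        = ∑ i, ∑ j, ⟪φ i (η j), η i⟫_ℝ + ∑ i, ∑ j, ⟪φ i (η j), η i⟫_ℝ := by
      nth_rw 4 [Finset.sum_comm]
      simp only [← Finset.sum_add_distrib]
      exact Finset.sum_congr rfl fun i _ => Finset.sum_congr rfl fun j _ => by
        rw [hk, real_inner_comm (φ j (η i))]
    have h5 := hdiss z u
    have h6 := hTη η (M η)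
    change _ = ∑ i, ∑ j, ⟪k i j (η j), L i (η i)⟫_ℝ - ⟪_, ∑ i, G' i (L i (η i))⟫_ℝ at h6
    rw [← hz, h1] at h6
    rw [h6]
    linarith
  have h := inner_nonneg_of_lyapunov hTs hMpos hTM (WithLp.toLp 2 c)
  rw [hTη] at h
  have h0 := hQ0 (∑ i, G' i (c i))
  simp only at h
  linarith

end Lyapunov

/-! ### Components of slice functions -/

section Stem

variable {l m n : Type*}

theorem coe_smul_matrix (r : ℝ) (M : Matrix m n ℍ[ℝ]) : (r : ℍ[ℝ]) • M = r • M := by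
  ext i j : 1
  simp [Quaternion.coe_mul_eq_smul]

theorem stemRe_neg_right (f : ℍ[ℝ] → Matrix m n ℍ[ℝ]) (x y : ℝ) :
    stemRe f x (-y) = stemRe f x y := by
  rw [stemRe, stemRe, neg_neg, add_comm]

theorem stemIm_neg_right (f : ℍ[ℝ] → Matrix m n ℍ[ℝ]) (x y : ℝ) :
    stemIm f x (-y) = -stemIm f x y := by
  rw [stemIm, stemIm, neg_neg y, ← neg_sub (f (slicePoint unitI x y)), smul_neg, smul_neg]

theorem slicePoint_re {I : ℍ[ℝ]} (hI : I.re = 0) (x y : ℝ) : (slicePoint I x y).re = x := by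
  simp [slicePoint, hI]

theorem slicePoint_im {I : ℍ[ℝ]} (hI : I.re = 0) (x y : ℝ) : (slicePoint I x y).im = y • I := by
  ext <;> simp [slicePoint, hI, mul_comm]

theorem norm_slicePoint_im {I : ℍ[ℝ]} (hI : I ∈ imagSphere) (x y : ℝ) :
    ‖(slicePoint I x y).im‖ = |y| := by
  rw [slicePoint_im hI.1, norm_smul, hI.2, mul_one, Real.norm_eq_abs]

theorem sliceUnit_slicePoint {I : ℍ[ℝ]} (hI : I ∈ imagSphere) (x y : ℝ) :
    sliceUnit (slicePoint I x y) = (|y|⁻¹ * y) • I := by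
  rw [sliceUnit, norm_slicePoint_im hI, slicePoint_im hI.1, smul_smul]

theorem re_add_sliceUnit_mul (p : ℍ[ℝ]) : (p.re : ℍ[ℝ]) + sliceUnit p * (‖p.im‖ : ℝ) = p := by
  by_cases h : p.im = 0
  · rw [h, norm_zero, Quaternion.coe_zero, mul_zero, add_zero]
    conv_rhs => rw [← Quaternion.re_add_im p, h, add_zero]
  · rw [sliceUnit, Quaternion.mul_coe_eq_smul, smul_smul, mul_inv_cancel₀ (norm_ne_zero_iff.2 h),
      one_smul]
    exact Quaternion.re_add_im p

theorem im_mul_self (p : ℍ[ℝ]) : p.im * p.im = ((-‖p.im‖ ^ 2 : ℝ) : ℍ[ℝ]) := by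
  have h : star p.im = -p.im := by ext <;> simp
  have h2 := Quaternion.self_mul_star p.im
  rw [h, Quaternion.normSq_eq_norm_mul_self, ← sq] at h2
  rw [Quaternion.coe_neg, ← h2, mul_neg, neg_neg]

theorem sliceUnit_mem {p : ℍ[ℝ]} (h : p.im ≠ 0) : sliceUnit p ∈ imagSphere := by
  refine ⟨by simp [sliceUnit], ?_⟩
  rw [sliceUnit, norm_smul, norm_inv, norm_norm, inv_mul_cancel₀ (norm_ne_zero_iff.2 h)]

theorem sliceUnit_mul_sliceUnit_smul (p : ℍ[ℝ]) :
    sliceUnit p * (sliceUnit p * (‖p.im‖ : ℝ)) = ((-‖p.im‖ : ℝ) : ℍ[ℝ]) := by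
  by_cases h : ‖p.im‖ = 0
  · simp [h]
  · rw [sliceUnit, Quaternion.mul_coe_eq_smul, smul_smul, mul_inv_cancel₀ h, one_smul,
      smul_mul_assoc, im_mul_self, Quaternion.smul_coe]
    congr 1
    field_simp

/-- `p` is the point `x + I y`, `y = ‖im p‖`, of the slice through it. -/
theorem slicePoint_sliceUnit (p : ℍ[ℝ]) : slicePoint (sliceUnit p) p.re ‖p.im‖ = p :=
  re_add_sliceUnit_mul p

/-- `stemRe` and `stemIm` at `p` depend only on values at points of the sphere of `p`. -/
theorem AxiallySymmetric.unitI_mem {Ω : Set ℍ[ℝ]} (h : AxiallySymmetric Ω) {p : ℍ[ℝ]}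
    (hp : p ∈ Ω) : slicePoint unitI p.re ‖p.im‖ ∈ Ω ∧ slicePoint unitI p.re (-‖p.im‖) ∈ Ω := by
  by_cases h0 : p.im = 0
  · have : (p.re : ℍ[ℝ]) = p := by
      have := re_add_sliceUnit_mul p
      rwa [h0, norm_zero, Quaternion.coe_zero, mul_zero, add_zero] at this
    simpa [h0, slicePoint, this] using hp
  · rw [← slicePoint_sliceUnit p] at hp
    refine ⟨h _ _ _ (sliceUnit_mem h0) _ QuatKYP.unitI_mem hp, ?_⟩
    have hneg : -unitI ∈ imagSphere := by
      have := QuatKYP.unitI_mem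
      exact ⟨by simp [this.1], by rw [norm_neg, this.2]⟩
    have := h _ _ _ (sliceUnit_mem h0) _ hneg hp
    simpa [slicePoint] using this

/-- The function with stem `α, β`: `α (x, y) + I β (x, y)` at `x + I y`, `y ≥ 0`. -/
noncomputable def sliceExt (α β : ℝ → ℝ → Matrix m n ℍ[ℝ]) (p : ℍ[ℝ]) : Matrix m n ℍ[ℝ] :=
  α p.re ‖p.im‖ + sliceUnit p • β p.re ‖p.im‖

theorem sliceExt_slicePoint {α β : ℝ → ℝ → Matrix m n ℍ[ℝ]} {x : ℝ}
    (hα : ∀ y, α x (-y) = α x y) (hβ : ∀ y, β x (-y) = -β x y) {I : ℍ[ℝ]} (hI : I ∈ imagSphere)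
    (y : ℝ) : sliceExt α β (slicePoint I x y) = α x y + I • β x y := by
  rw [sliceExt, norm_slicePoint_im hI, sliceUnit_slicePoint hI, slicePoint_re hI.1]
  rcases lt_trichotomy y 0 with h | h | h
  · rw [abs_of_neg h, hα, hβ, inv_neg, neg_mul, inv_mul_cancel₀ h.ne]
    simp
  · subst h
    have : β x 0 = 0 := by
      have h := hβ 0
      rw [neg_zero] at h
      have h2 : (2 : ℝ) • β x 0 = 0 := by
        rw [two_smul]; nth_rw 2 [h]; exact add_neg_cancel _
      exact (smul_eq_zero_iff_right two_ne_zero).1 h2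
    simp [this]
  · rw [abs_of_pos h, inv_mul_cancel₀ h.ne', one_smul]

theorem stem_sliceExt {α β : ℝ → ℝ → Matrix m n ℍ[ℝ]} {x : ℝ}
    (hα : ∀ y, α x (-y) = α x y) (hβ : ∀ y, β x (-y) = -β x y) (y : ℝ) :
    stemRe (sliceExt α β) x y = α x y ∧ stemIm (sliceExt α β) x y = β x y :=
  stem_eq (α := fun z => α z.1 z.2) (β := fun z => β z.1 z.2) (hα y) (hβ y)
    (sliceExt_slicePoint hα hβ unitI_mem y) (sliceExt_slicePoint hα hβ unitI_mem (-y))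

theorem starMul_eq_sliceExt [Fintype m] (f : ℍ[ℝ] → Matrix l m ℍ[ℝ])
    (g : ℍ[ℝ] → Matrix m n ℍ[ℝ]) : starMul f g =
      sliceExt (fun x y => stemRe f x y * stemRe g x y - stemIm f x y * stemIm g x y)
        (fun x y => stemRe f x y * stemIm g x y + stemIm f x y * stemRe g x y) := rfl

/-- The stem of a star product is the complex product of the stems. -/
theorem stem_starMul [Fintype m] (f : ℍ[ℝ] → Matrix l m ℍ[ℝ]) (g : ℍ[ℝ] → Matrix m n ℍ[ℝ])
    (x y : ℝ) :
    stemRe (starMul f g) x y = stemRe f x y * stemRe g x y - stemIm f x y * stemIm g x y ∧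
    stemIm (starMul f g) x y = stemRe f x y * stemIm g x y + stemIm f x y * stemRe g x y := by
  rw [starMul_eq_sliceExt]
  refine stem_sliceExt (fun y => ?_) (fun y => ?_) y
  · simp only [stemRe_neg_right, stemIm_neg_right, Matrix.neg_mul, Matrix.mul_neg, neg_neg]
  · simp only [stemRe_neg_right, stemIm_neg_right, Matrix.neg_mul, Matrix.mul_neg, neg_add]

theorem stem_const (M : Matrix m n ℍ[ℝ]) (x y : ℝ) :
    stemRe (fun _ => M) x y = M ∧ stemIm (fun _ => M) x y = 0 :=
  stem_eq (α := fun _ => M) (β := fun _ => 0) rfl (by simp) (by simp) (by simp)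

theorem stem_add_const (f : ℍ[ℝ] → Matrix m n ℍ[ℝ]) (M : Matrix m n ℍ[ℝ]) (x y : ℝ) :
    stemRe (fun p => f p + M) x y = stemRe f x y + M ∧
      stemIm (fun p => f p + M) x y = stemIm f x y := by
  constructor
  · rw [stemRe, stemRe, add_add_add_comm, smul_add, ← two_smul ℝ M, smul_smul]
    norm_num
  · rw [stemIm, stemIm, add_sub_add_right_eq_sub]

theorem stem_pencil [DecidableEq m] (A : Matrix m m ℍ[ℝ]) (x y : ℝ) :
    stemRe (pencil A) x y = x • (1 : Matrix m m ℍ[ℝ]) - A ∧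
      stemIm (pencil A) x y = y • (1 : Matrix m m ℍ[ℝ]) := by
  have h : ∀ I : ℍ[ℝ], ∀ y : ℝ, pencil A (slicePoint I x y) =
      (x • (1 : Matrix m m ℍ[ℝ]) - A) + I • (y • (1 : Matrix m m ℍ[ℝ])) := by
    intro I y
    rw [pencil, slicePoint, add_smul, mul_smul, coe_smul_matrix, coe_smul_matrix]
    abel
  exact stem_eq (α := fun z => z.1 • (1 : Matrix m m ℍ[ℝ]) - A)
    (β := fun z => z.2 • (1 : Matrix m m ℍ[ℝ])) rfl (by simp) (h _ _) (h _ _)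

/-- `f` is at `p` the value of the slice function determined by its stem. -/
def IsSliceAt (f : ℍ[ℝ] → Matrix m n ℍ[ℝ]) (p : ℍ[ℝ]) : Prop :=
  f p = stemRe f p.re ‖p.im‖ + sliceUnit p • stemIm f p.re ‖p.im‖

theorem isSliceAt_starMul [Fintype m] (f : ℍ[ℝ] → Matrix l m ℍ[ℝ]) (g : ℍ[ℝ] → Matrix m n ℍ[ℝ])
    (p : ℍ[ℝ]) : IsSliceAt (starMul f g) p := by
  rw [IsSliceAt, (stem_starMul f g _ _).1, (stem_starMul f g _ _).2]
  rfl

theorem IsSliceAt.add_const {f : ℍ[ℝ] → Matrix m n ℍ[ℝ]} {p : ℍ[ℝ]} (h : IsSliceAt f p)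
    (M : Matrix m n ℍ[ℝ]) : IsSliceAt (fun p => f p + M) p := by
  rw [IsSliceAt, (stem_add_const f M _ _).1, (stem_add_const f M _ _).2, h]
  abel

theorem IsSliceAt.congr {f g : ℍ[ℝ] → Matrix m n ℍ[ℝ]} {Ω : Set ℍ[ℝ]} (hΩ : AxiallySymmetric Ω)
    (hfg : ∀ p ∈ Ω, f p = g p) {p : ℍ[ℝ]} (hp : p ∈ Ω) (h : IsSliceAt g p) : IsSliceAt f p := by
  have h1 := hfg _ (hΩ.unitI_mem hp).1
  have h2 := hfg _ (hΩ.unitI_mem hp).2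
  rw [IsSliceAt, hfg p hp, h, stemRe, stemRe, stemIm, stemIm, h1, h2]

/-- Left multiplication by `p` acts on the stem as complex multiplication by `x + I y`. -/
theorem IsSliceAt.smul_eq {f : ℍ[ℝ] → Matrix m n ℍ[ℝ]} {p : ℍ[ℝ]} (h : IsSliceAt f p) :
    p • f p = (p.re • stemRe f p.re ‖p.im‖ - ‖p.im‖ • stemIm f p.re ‖p.im‖) +
      sliceUnit p • (‖p.im‖ • stemRe f p.re ‖p.im‖ + p.re • stemIm f p.re ‖p.im‖) := by
  have h1 : ∀ M : Matrix m n ℍ[ℝ], p • M = p.re • M + sliceUnit p • ‖p.im‖ • M := by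
    intro M
    rw [← coe_smul_matrix, ← coe_smul_matrix, smul_smul, ← add_smul, re_add_sliceUnit_mul]
  have h2 : ∀ M : Matrix m n ℍ[ℝ], sliceUnit p • ‖p.im‖ • sliceUnit p • M = -(‖p.im‖ • M) := by
    intro M
    rw [← coe_smul_matrix, ← coe_smul_matrix, smul_smul, smul_smul, mul_assoc,
      Quaternion.coe_commutes,
      sliceUnit_mul_sliceUnit_smul, Quaternion.coe_neg, neg_smul]
  conv_lhs => rw [h]
  rw [smul_add, h1, h1 (sliceUnit p • _), h2, smul_comm p.re (sliceUnit p), smul_add]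
  abel

end Stem

/-! ### Sylvester equations -/

section Sylvester

variable {l m n : Type*}

theorem stem_eq_one_zero [DecidableEq m] {f : ℍ[ℝ] → Matrix m m ℍ[ℝ]} {Ω : Set ℍ[ℝ]}
    (hΩ : AxiallySymmetric Ω) (h : ∀ p ∈ Ω, f p = 1) {p : ℍ[ℝ]} (hp : p ∈ Ω) :
    stemRe f p.re ‖p.im‖ = 1 ∧ stemIm f p.re ‖p.im‖ = 0 := by
  obtain ⟨h1, h2⟩ := hΩ.unitI_mem hp
  rw [stemRe, stemIm, h _ h1, h _ h2, ← two_smul ℝ, smul_smul]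
  simp

/-- The function `G = C ⋆ (p - A)^{-⋆}` satisfies `p G(p) - G(p) A = C`. -/
theorem isStarInverse_sylvester [Fintype m] [DecidableEq m] {A : Matrix m m ℍ[ℝ]}
    {R : ℍ[ℝ] → Matrix m m ℍ[ℝ]} {Ω : Set ℍ[ℝ]} (hΩ : AxiallySymmetric Ω)
    (hR : IsStarInverseOn (pencil A) R Ω) (C : Matrix n m ℍ[ℝ]) {p : ℍ[ℝ]} (hp : p ∈ Ω) :
    p • starMul (fun _ => C) R p - starMul (fun _ => C) R p * A = C := by
  obtain ⟨h1, h2⟩ := stem_eq_one_zero hΩ hR.inv_mul hp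
  rw [(stem_starMul _ _ _ _).1, (stem_pencil A _ _).1, (stem_pencil A _ _).2] at h1
  rw [(stem_starMul _ _ _ _).2, (stem_pencil A _ _).1, (stem_pencil A _ _).2] at h2
  rw [(isSliceAt_starMul _ _ p).smul_eq]
  have hs := isSliceAt_starMul (fun _ => C) R p
  rw [IsSliceAt] at hs
  rw [hs]
  rw [(stem_starMul _ _ _ _).1, (stem_starMul _ _ _ _).2, (stem_const C _ _).1,
    (stem_const C _ _).2]
  simp only [Matrix.zero_mul, sub_zero, add_zero, Matrix.mul_sub, Matrix.mul_smul, Matrix.mul_one]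
    at h1 h2 ⊢
  have h3 := congrArg (fun M => C * M) h1
  have h4 := congrArg (fun M => sliceUnit p • (C * M)) h2
  simp only [Matrix.mul_sub, Matrix.mul_add, Matrix.mul_smul, Matrix.mul_one, Matrix.mul_zero,
    smul_zero, ← Matrix.mul_assoc] at h3 h4
  have h5 := congrArg₂ (· + ·) h3 h4
  simp only [add_zero] at h5
  refine Eq.trans ?_ h5
  rw [Matrix.add_mul, Matrix.smul_mul]
  simp only [smul_add, smul_sub]
  abel

theorem starMul_const_right [Fintype m] {f : ℍ[ℝ] → Matrix l m ℍ[ℝ]} {p : ℍ[ℝ]}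
    (hf : IsSliceAt f p) (B : Matrix m n ℍ[ℝ]) :
    starMul f (fun _ => B) p = f p * B := by
  rw [isSliceAt_starMul f _ p, (stem_starMul _ _ _ _).1, (stem_starMul _ _ _ _).2,
    (stem_const B _ _).1, (stem_const B _ _).2, hf]
  simp [Matrix.add_mul]

/-- The Sylvester operator `x ↦ p x + x s` is injective when `Re p + Re s > 0`: multiply by
`x̄` and take real parts. -/
theorem quaternion_sylvester_eq_zero {p s x : ℍ[ℝ]} (h : 0 < p.re + s.re)
    (hx : p * x + x * s = 0) : x = 0 := by
  have h1 := congrArg (fun z => (star x * z).re) hx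
  have h2 : (star x * (p * x + x * s)).re = (p.re + s.re) * Quaternion.normSq x := by
    rw [Quaternion.normSq_def']
    simp
    ring
  simp only [h2, mul_zero, Quaternion.re_zero] at h1
  exact Quaternion.normSq_eq_zero.1 ((mul_eq_zero.1 h1).resolve_left h.ne')

/-- The function `(p + q̄)^{-⋆}` is the pointwise solution `s` of `p s + s q̄ = 1`. -/
theorem addConjStarInv_sylvester {p q : ℍ[ℝ]} (hp : 0 < p.re) (hq : 0 < q.re) :
    p * addConjStarInv q p + addConjStarInv q p * star q = 1 := by
  obtain ⟨w, hw⟩ : ∃ w, w = ((‖q‖ ^ 2 : ℝ) : ℍ[ℝ]) + ((2 * q.re : ℝ) : ℍ[ℝ]) * p + p ^ 2 :=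
    ⟨_, rfl⟩
  have hqq : q * star q = ((‖q‖ ^ 2 : ℝ) : ℍ[ℝ]) := by
    rw [Quaternion.self_mul_star, Quaternion.normSq_eq_norm_mul_self, sq]
  have hadd : q + star q = ((2 * q.re : ℝ) : ℍ[ℝ]) := by
    rw [Quaternion.self_add_star']
  have hwp : p * w = w * p := by
    rw [hw]
    simp only [mul_add, add_mul, pow_two, ← mul_assoc, ← Quaternion.coe_commutes]
  have hw2 : p * (p + q) + (p + q) * star q = w := by
    rw [hw, ← hqq, ← hadd]
    have h3 : (q + star q) * p = p * (q + star q) := by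
      rw [hadd]; exact Quaternion.coe_commutes _ _
    rw [h3]
    noncomm_ring
  have hw0 : w ≠ 0 := by
    intro h0
    rw [h0] at hw2
    have h3 : p * (p + q) + (p + q) * star q = 0 := hw2
    have h4 := quaternion_sylvester_eq_zero (by simp; linarith) h3
    have h5 := congrArg (fun z => z.re) h4
    simp at h5
    linarith
  have hwinv : p * w⁻¹ = w⁻¹ * p := by
    rw [eq_inv_mul_iff_mul_eq₀ hw0, ← mul_assoc, ← hwp, mul_assoc, mul_inv_cancel₀ hw0, mul_one]
  rw [addConjStarInv, ← hw, ← mul_assoc, hwinv, mul_assoc, mul_assoc, ← mul_add, hw2,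
    inv_mul_cancel₀ hw0]

/-- The star product that defines `K_φ` amounts to the pointwise Sylvester equation
`p K_φ(p, q) + K_φ(p, q) q̄ = φ(p) + φ(q)^*`. -/
theorem kernel_sylvester [Fintype n] [DecidableEq n] {φ : ℍ[ℝ] → Matrix n n ℍ[ℝ]} {p q : ℍ[ℝ]}
    (hφ : IsSliceAt φ p) (hp : 0 < p.re) (hq : 0 < q.re) :
    p • kernel φ p q + kernel φ p q * (star q • 1) = φ p + (φ q)ᴴ := by
  obtain ⟨S, hS⟩ : ∃ S : ℍ[ℝ] → Matrix n n ℍ[ℝ], S = fun p' => addConjStarInv q p' • 1 := ⟨_, rfl⟩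
  obtain ⟨F, hF⟩ : ∃ F : ℍ[ℝ] → Matrix n n ℍ[ℝ], F = fun p' => φ p' + (φ q)ᴴ := ⟨_, rfl⟩
  have hFp : IsSliceAt F p := hF ▸ hφ.add_const _
  have hk : kernel φ p q = starMul F S p := by rw [hF, hS]; rfl
  have hpt : ∀ y, slicePoint unitI p.re y • S (slicePoint unitI p.re y) +
      S (slicePoint unitI p.re y) * (star q • 1) = 1 := by
    intro y
    have h := addConjStarInv_sylvester (p := slicePoint unitI p.re y) (q := q)
      (by rw [slicePoint_re unitI_mem.1]; exact hp) hq
    simp only [hS]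
    rw [smul_smul, smul_mul_assoc, one_mul, smul_smul, ← add_smul, h, one_smul]
  obtain ⟨Q, hQ⟩ : ∃ Q : Matrix n n ℍ[ℝ], Q = star q • 1 := ⟨_, rfl⟩
  obtain ⟨y, hy⟩ : ∃ y, y = ‖p.im‖ := ⟨_, rfl⟩
  rw [← hQ] at hpt ⊢
  have h1 := hpt y
  have h2 := hpt (-y)
  have hsl : ∀ y M, slicePoint unitI p.re y • M = p.re • M + unitI • y • (M : Matrix n n ℍ[ℝ]) := by
    intro y M
    rw [slicePoint, add_smul, mul_smul, coe_smul_matrix, coe_smul_matrix]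
  rw [hsl] at h1 h2
  obtain ⟨T, hT⟩ : ∃ T : Matrix n n ℍ[ℝ] →ₗ[ℝ] Matrix n n ℍ[ℝ], ∀ M, unitI • M = T M :=
    ⟨DistribSMul.toLinearMap ℝ _ unitI, fun _ => rfl⟩
  have hII : ∀ M, T (T M) = -M := by
    intro M
    rw [← hT, ← hT, smul_smul, unitI_mul_self, neg_one_smul]
  have hre : p.re • stemRe S p.re y - y • stemIm S p.re y + stemRe S p.re y * Q = 1 := by
    have : (1 : Matrix n n ℍ[ℝ]) = (1 / 2 : ℝ) • (1 + 1) := by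
      rw [← two_smul ℝ, smul_smul]; norm_num
    rw [this]
    nth_rw 1 [← h1]
    rw [← h2, stemRe, stemIm, Matrix.smul_mul, Matrix.add_mul]
    simp only [hT, map_sub, map_smul]
    module
  have him : y • stemRe S p.re y + p.re • stemIm S p.re y + stemIm S p.re y * Q = 0 := by
    have : (0 : Matrix n n ℍ[ℝ]) = -((1 / 2 : ℝ) • (unitI • (1 - 1))) := by simp
    rw [this]
    nth_rw 1 [← h1]
    rw [← h2, stemRe, stemIm, Matrix.neg_mul, Matrix.smul_mul, Matrix.smul_mul, Matrix.sub_mul]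
    simp only [hT, map_add, map_sub, map_smul, hII]
    module
  rw [hk, (isSliceAt_starMul F S p).smul_eq]
  have hs := isSliceAt_starMul F S p
  rw [IsSliceAt] at hs
  rw [hs]
  have hFp' : φ p + (φ q)ᴴ = F p := by rw [hF]
  rw [hFp', hFp, (stem_starMul _ _ _ _).1, (stem_starMul _ _ _ _).2, ← hy]
  obtain ⟨T', hT'⟩ : ∃ T : Matrix n n ℍ[ℝ] →ₗ[ℝ] Matrix n n ℍ[ℝ], ∀ M, sliceUnit p • M = T M :=
    ⟨DistribSMul.toLinearMap ℝ _ (sliceUnit p), fun _ => rfl⟩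
  have h3 := congrArg (fun M => stemRe F p.re y * M) hre
  have h4 := congrArg (fun M => stemIm F p.re y * M) him
  have h5 := congrArg (fun M => T' (stemIm F p.re y * M)) hre
  have h6 := congrArg (fun M => T' (stemRe F p.re y * M)) him
  simp only [Matrix.mul_add, Matrix.mul_sub, Matrix.mul_smul, Matrix.mul_one, Matrix.mul_zero,
    map_zero, map_add, map_sub, map_smul, ← Matrix.mul_assoc] at h3 h4 h5 h6
  rw [Matrix.add_mul, Matrix.smul_mul]
  simp only [Matrix.add_mul, Matrix.sub_mul, hT', map_add, map_sub, map_smul]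
  have h7 := congrArg₂ (· + ·) (congrArg₂ (· - ·) h3 h4) (congrArg₂ (· + ·) h5 h6)
  simp only [add_zero, sub_zero] at h7
  refine Eq.trans ?_ h7
  module

end Sylvester

/-! ### The star resolvent -/

section Resolvent

/-- The real quadratic `(x - A)² + y² = A² - 2 x A + x² + y²` at `z = (x, y)`; the spheres
`x + 𝕊 y` at which it is not invertible form the `S`-spectrum of `A`. -/
noncomputable def spherePoly {𝔸 : Type*} [Ring 𝔸] [Algebra ℝ 𝔸] (A : 𝔸) (z : ℝ × ℝ) : 𝔸 :=
  (z.1 • 1 - A) * (z.1 • 1 - A) + (z.2 * z.2) • 1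

/-- The components of the star resolvent satisfy the Cauchy-Riemann equations. -/
theorem spherePoly_inverse_hasFDerivAt {𝔸 : Type*} [NormedRing 𝔸] [NormedAlgebra ℝ 𝔸]
    [CompleteSpace 𝔸] (A : 𝔸) (z : ℝ × ℝ) (hz : IsUnit (spherePoly A z)) :
    ∃ α' β' : ℝ × ℝ →L[ℝ] 𝔸,
      HasFDerivAt (fun w : ℝ × ℝ => (w.1 • 1 - A) * Ring.inverse (spherePoly A w)) α' z ∧
      HasFDerivAt (fun w : ℝ × ℝ => -(w.2 • Ring.inverse (spherePoly A w))) β' z ∧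
      α' (1, 0) = β' (0, 1) ∧ α' (0, 1) = -β' (1, 0) := by
  obtain ⟨u, hu⟩ := hz
  have hfst : HasFDerivAt (fun w : ℝ × ℝ => w.1) (ContinuousLinearMap.fst ℝ ℝ ℝ) z :=
    hasFDerivAt_fst
  have hsnd : HasFDerivAt (fun w : ℝ × ℝ => w.2) (ContinuousLinearMap.snd ℝ ℝ ℝ) z :=
    hasFDerivAt_snd
  have hS := (hfst.smul_const (1 : 𝔸)).sub_const A
  have hQ : HasFDerivAt (spherePoly A) _ z :=
    (hS.fun_mul' hS).add ((hsnd.mul hsnd).smul_const (1 : 𝔸))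
  have hinv := hasFDerivAt_ringInverse (𝕜 := ℝ) u
  rw [hu] at hinv
  have hW := hinv.comp z hQ
  have hα := hS.fun_mul' hW
  have hβ := (hsnd.smul hW).neg
  refine ⟨_, _, hα, hβ, ?_⟩
  have hW' : Ring.inverse (spherePoly A z) = ((u⁻¹ : 𝔸ˣ) : 𝔸) := by rw [← hu, Ring.inverse_unit]
  obtain ⟨W, hWdef⟩ : ∃ W, W = ((u⁻¹ : 𝔸ˣ) : 𝔸) := ⟨_, rfl⟩
  obtain ⟨S, hSdef⟩ : ∃ S, S = z.1 • 1 - A := ⟨_, rfl⟩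
  have hSQ : Commute S (u : 𝔸) := by
    rw [hu, spherePoly, ← hSdef]
    exact ((Commute.refl S).mul_right (Commute.refl S)).add_right
      ((Commute.one_right S).smul_right _)
  have hSW : W * S = S * W := by rw [hWdef]; exact hSQ.units_inv_right.symm
  have hSW2 : ∀ X, W * (S * X) = S * (W * X) := fun X => by
    rw [← mul_assoc, hSW, mul_assoc]
  have hone : S * (S * (W * W)) + (z.2 * z.2) • (W * W) = W := by
    have : (u : 𝔸) * W = 1 := by rw [hWdef]; exact u.mul_inv
    calc _ = (spherePoly A z * W) * W := by
            rw [spherePoly, ← hSdef]; simp [add_mul, mul_assoc]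
      _ = W := by rw [← hu, this, one_mul]
  have hSS : S * (S * (W * W)) = W - (z.2 * z.2) • (W * W) := eq_sub_of_add_eq hone
  simp [hW', ← hWdef, ← hSdef, hSW, mul_assoc]
  rw [hSS]
  constructor <;> module

attribute [local instance] Matrix.linftyOpNormedRing Matrix.linftyOpNormedAlgebra

variable {m : Type*} [Fintype m] [DecidableEq m]

theorem spherePoly_neg_right {𝔸 : Type*} [Ring 𝔸] [Algebra ℝ 𝔸] (A : 𝔸) (x y : ℝ) :
    spherePoly A (x, -y) = spherePoly A (x, y) := by
  simp [spherePoly]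

/-- The star resolvent of `A` with stem `((x - A) Q⁻¹, -y Q⁻¹)`, `Q = A² - 2 x A + x² + y²`. -/
noncomputable def starResolvent (A : Matrix m m ℍ[ℝ]) : ℍ[ℝ] → Matrix m m ℍ[ℝ] :=
  sliceExt (fun x y => (x • 1 - A) * Ring.inverse (spherePoly A (x, y)))
    (fun x y => -(y • Ring.inverse (spherePoly A (x, y))))

theorem stem_starResolvent (A : Matrix m m ℍ[ℝ]) (x y : ℝ) :
    stemRe (starResolvent A) x y = (x • 1 - A) * Ring.inverse (spherePoly A (x, y)) ∧
    stemIm (starResolvent A) x y = -(y • Ring.inverse (spherePoly A (x, y))) :=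
  stem_sliceExt (fun y => by simp only [spherePoly_neg_right])
    (fun y => by simp only [spherePoly_neg_right, neg_smul]) y

theorem isStarInverseOn_starResolvent (A : Matrix m m ℍ[ℝ]) :
    IsStarInverseOn (pencil A) (starResolvent A)
      {p | IsUnit (spherePoly A (p.re, ‖p.im‖))} := by
  have hcomm : ∀ x y : ℝ, IsUnit (spherePoly A (x, y)) →
      Ring.inverse (spherePoly A (x, y)) * (x • 1 - A) =
        (x • 1 - A) * Ring.inverse (spherePoly A (x, y)) := by
    rintro x y ⟨u, hu⟩
    have hSQ : Commute (x • 1 - A) (u : Matrix m m ℍ[ℝ]) := by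
      rw [hu, spherePoly]
      exact ((Commute.refl _).mul_right (Commute.refl _)).add_right
        ((Commute.one_right _).smul_right _)
    rw [← hu, Ring.inverse_unit]
    exact hSQ.units_inv_right.symm
  have hone : ∀ x y : ℝ, IsUnit (spherePoly A (x, y)) →
      (x • 1 - A) * ((x • 1 - A) * Ring.inverse (spherePoly A (x, y))) +
        (y * y) • Ring.inverse (spherePoly A (x, y)) = 1 := by
    intro x y h
    have h1 := Ring.mul_inverse_cancel _ h
    generalize Ring.inverse (spherePoly A (x, y)) = W at h1 ⊢
    refine Eq.trans ?_ h1
    rw [spherePoly]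
    simp only [Matrix.add_mul, Matrix.mul_assoc, Matrix.smul_mul, Matrix.one_mul]
  refine ⟨?_, fun p hp => ?_, fun p hp => ?_⟩
  · refine ⟨fun z => (z.1 • 1 - A) * Ring.inverse (spherePoly A z),
      fun z => -(z.2 • Ring.inverse (spherePoly A z)), fun x y => ?_, fun x y => ?_, ?_⟩
    · simp only [spherePoly_neg_right]
    · simp only [spherePoly_neg_right, neg_smul]
    · intro x y I hI hmem
      refine ⟨sliceExt_slicePoint (fun y => by simp only [spherePoly_neg_right])
        (fun y => by simp only [spherePoly_neg_right, neg_smul]) hI y, fun i j => ?_⟩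
      have hu : IsUnit (spherePoly A (x, y)) := by
        rw [Set.mem_ofPred_eq, slicePoint_re hI.1, norm_slicePoint_im hI] at hmem
        rcases abs_choice y with h | h <;> rw [h] at hmem
        · exact hmem
        · rwa [spherePoly_neg_right] at hmem
      obtain ⟨α', β', hα, hβ, h1, h2⟩ := spherePoly_inverse_hasFDerivAt A (x, y) hu
      let e : Matrix m m ℍ[ℝ] →L[ℝ] ℍ[ℝ] :=
        LinearMap.toContinuousLinearMap (Matrix.entryLinearMap ℝ ℍ[ℝ] i j)
      have hα2 := e.hasFDerivAt.comp (x, y) hα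
      have hβ2 := e.hasFDerivAt.comp (x, y) hβ
      refine ⟨hα2.differentiableAt, hβ2.differentiableAt, ?_, ?_⟩
      · exact (congrArg (fun f => f (1, 0)) hα2.fderiv).trans
          ((congrArg e h1).trans (congrArg (fun f => f (0, 1)) hβ2.fderiv).symm)
      · exact (congrArg (fun f => f (0, 1)) hα2.fderiv).trans
          (((congrArg e h2).trans (map_neg e _)).trans
            (congrArg (fun f => -f (1, 0)) hβ2.fderiv).symm)
  · have h1 := hone _ _ hp
    rw [isSliceAt_starMul (pencil A) (starResolvent A) p, (stem_starMul _ _ _ _).1,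
      (stem_starMul _ _ _ _).2, (stem_pencil A _ _).1, (stem_pencil A _ _).2,
      (stem_starResolvent A _ _).1, (stem_starResolvent A _ _).2]
    simp only [Matrix.mul_neg, Matrix.mul_smul, Matrix.smul_mul, Matrix.one_mul,
      sub_neg_eq_add, smul_smul, neg_add_cancel, smul_zero, add_zero]
    exact h1
  · have h1 := hone _ _ hp
    have h2 := hcomm _ _ hp
    rw [isSliceAt_starMul (starResolvent A) (pencil A) p, (stem_starMul _ _ _ _).1,
      (stem_starMul _ _ _ _).2, (stem_pencil A _ _).1, (stem_pencil A _ _).2,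
      (stem_starResolvent A _ _).1, (stem_starResolvent A _ _).2, Matrix.mul_assoc, h2,
      Matrix.neg_mul, Matrix.neg_mul, Matrix.smul_mul, Matrix.smul_mul, h2]
    simp only [Matrix.mul_smul, Matrix.mul_one,
      sub_neg_eq_add, smul_smul, add_neg_cancel, smul_zero, add_zero]
    exact h1

theorem mem_starResolventSet {A : Matrix m m ℍ[ℝ]} {p : ℍ[ℝ]}
    (hp : IsUnit (spherePoly A (p.re, ‖p.im‖))) : p ∈ starResolventSet A := by
  refine ⟨{p | IsUnit (spherePoly A (p.re, ‖p.im‖))}, ?_, ?_, hp, _,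
    isStarInverseOn_starResolvent A⟩
  · refine Units.isOpen.preimage (f := fun p : ℍ[ℝ] => spherePoly A (p.re, ‖p.im‖)) ?_
    have h1 : Continuous fun p : ℍ[ℝ] => p.re := Quaternion.continuous_re
    have h2 : Continuous fun p : ℍ[ℝ] => ‖p.im‖ := Quaternion.continuous_im.norm
    have h3 : Continuous fun p : ℍ[ℝ] => p.re • (1 : Matrix m m ℍ[ℝ]) - A :=
      (h1.smul continuous_const).sub continuous_const
    exact (h3.mul h3).add ((h2.mul h2).smul continuous_const)
  · intro x y I hI J hJ h
    rw [Set.mem_ofPred_eq, slicePoint_re hI.1, norm_slicePoint_im hI] at h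
    rwa [Set.mem_ofPred_eq, slicePoint_re hJ.1, norm_slicePoint_im hJ]

theorem axiallySymmetric_starResolventSet (A : Matrix m m ℍ[ℝ]) :
    AxiallySymmetric (starResolventSet A) := by
  rintro x y I hI J hJ ⟨Ω, h1, h2, h3, h4⟩
  exact ⟨Ω, h1, h2, h2 x y I hI J hJ h3, h4⟩

theorem coe_mem_starResolventSet {A : Matrix m m ℍ[ℝ]} {a : ℝ}
    (ha : IsUnit (a • (1 : Matrix m m ℍ[ℝ]) - A)) : (a : ℍ[ℝ]) ∈ starResolventSet A := by
  refine mem_starResolventSet ?_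
  have : ‖(a : ℍ[ℝ]).im‖ = 0 := by simp
  rw [this, Quaternion.re_coe, spherePoly, mul_zero, zero_smul, add_zero]
  exact ha.mul ha

end Resolvent

/-! ### Quaternionic matrices as real operators -/

section VecMap

variable {l m n : Type*} [Fintype n]

/-- The real-linear map `v ↦ M v` between the real Euclidean spaces of quaternionic vectors. -/
noncomputable def vecMap (M : Matrix m n ℍ[ℝ]) :
    PiLp 2 (fun _ : n => ℍ[ℝ]) →ₗ[ℝ] PiLp 2 (fun _ : m => ℍ[ℝ]) where
  toFun v := WithLp.toLp 2 (M *ᵥ v.ofLp)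
  map_add' v w := by simp [Matrix.mulVec_add]
  map_smul' r v := by simp [Matrix.mulVec_smul]

theorem vecMap_apply (M : Matrix m n ℍ[ℝ]) (v : PiLp 2 (fun _ : n => ℍ[ℝ])) :
    vecMap M v = WithLp.toLp 2 (M *ᵥ v.ofLp) := rfl

theorem inner_eq_re_dotProduct (v w : PiLp 2 (fun _ : n => ℍ[ℝ])) :
    ⟪v, w⟫_ℝ = (star v.ofLp ⬝ᵥ w.ofLp).re := by
  rw [PiLp.inner_apply, dotProduct]
  have hre : ∀ f : n → ℍ[ℝ], (∑ i, f i).re = ∑ i, (f i).re := fun f =>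
    map_sum (⟨⟨fun q => q.re, rfl⟩, fun _ _ => rfl⟩ : ℍ[ℝ] →+ ℝ) f _
  rw [hre]
  refine Finset.sum_congr rfl fun i _ => ?_
  rw [Quaternion.inner_def]
  simp

theorem inner_vecMap_left [Fintype m] (M : Matrix m n ℍ[ℝ]) (v : PiLp 2 (fun _ : n => ℍ[ℝ]))
    (w : PiLp 2 (fun _ : m => ℍ[ℝ])) : ⟪vecMap M v, w⟫_ℝ = ⟪v, vecMap Mᴴ w⟫_ℝ := by
  rw [inner_eq_re_dotProduct, inner_eq_re_dotProduct]
  simp only [vecMap_apply]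
  rw [Matrix.star_mulVec, Matrix.dotProduct_mulVec]

theorem vecMap_add (M M' : Matrix m n ℍ[ℝ]) (v : PiLp 2 (fun _ : n => ℍ[ℝ])) :
    vecMap (M + M') v = vecMap M v + vecMap M' v := by
  simp [vecMap_apply, Matrix.add_mulVec]

theorem vecMap_sub (M M' : Matrix m n ℍ[ℝ]) (v : PiLp 2 (fun _ : n => ℍ[ℝ])) :
    vecMap (M - M') v = vecMap M v - vecMap M' v := by
  simp [vecMap_apply, Matrix.sub_mulVec]

theorem vecMap_neg (M : Matrix m n ℍ[ℝ]) (v : PiLp 2 (fun _ : n => ℍ[ℝ])) :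
    vecMap (-M) v = -vecMap M v := by
  simp [vecMap_apply, Matrix.neg_mulVec]

theorem vecMap_smul (r : ℝ) (M : Matrix m n ℍ[ℝ]) (v : PiLp 2 (fun _ : n => ℍ[ℝ])) :
    vecMap (r • M) v = r • vecMap M v := by
  simp [vecMap_apply, Matrix.smul_mulVec]

theorem vecMap_mul [Fintype m] (M : Matrix l m ℍ[ℝ]) (M' : Matrix m n ℍ[ℝ])
    (v : PiLp 2 (fun _ : n => ℍ[ℝ])) : vecMap (M * M') v = vecMap M (vecMap M' v) := by
  simp [vecMap_apply, Matrix.mulVec_mulVec]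

theorem vecMap_one [DecidableEq n] (v : PiLp 2 (fun _ : n => ℍ[ℝ])) : vecMap 1 v = v := by
  simp [vecMap_apply]

/-- The adjoint of left multiplication by `q` is left multiplication by `q̄`. -/
theorem inner_vecMap_star_smul [Fintype m] [DecidableEq m] (q : ℍ[ℝ]) (M : Matrix m n ℍ[ℝ])
    (v : PiLp 2 (fun _ : n => ℍ[ℝ])) (w : PiLp 2 (fun _ : m => ℍ[ℝ])) :
    ⟪vecMap M v, vecMap (star q • 1) w⟫_ℝ = ⟪vecMap (q • M) v, w⟫_ℝ := by
  have h : (q • (1 : Matrix m m ℍ[ℝ]))ᴴ = star q • 1 := by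
    ext i j : 1
    by_cases hij : i = j
    · simp [hij]
    · simp [hij, Ne.symm hij]
  have h2 : q • M = (q • (1 : Matrix m m ℍ[ℝ])) * M := by rw [Matrix.smul_mul, Matrix.one_mul]
  rw [h2, vecMap_mul, inner_vecMap_left (q • 1), h]

theorem inner_vecMap_star_smul_self [Fintype m] [DecidableEq m] (q : ℍ[ℝ])
    (v : PiLp 2 (fun _ : m => ℍ[ℝ])) : ⟪vecMap (star q • 1) v, v⟫_ℝ = q.re * ⟪v, v⟫_ℝ := by
  rw [PiLp.inner_apply, PiLp.inner_apply, Finset.mul_sum]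
  refine Finset.sum_congr rfl fun i _ => ?_
  have : (vecMap (star q • (1 : Matrix m m ℍ[ℝ])) v).ofLp i = star q * v.ofLp i := by
    simp [vecMap_apply, Matrix.smul_mulVec]
  rw [this, Quaternion.inner_def, Quaternion.inner_def]
  simp
  ring

theorem isUnit_of_vecMap_injective [Fintype m] [DecidableEq m] {M : Matrix m m ℍ[ℝ]}
    (h : ∀ v, vecMap M v = 0 → v = 0) : IsUnit M := by
  have hinj : Function.Injective (vecMap M) :=
    (injective_iff_map_eq_zero _).2 h
  have hsurj := LinearMap.injective_iff_surjective.1 hinj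
  choose f hf using fun j : m => hsurj (WithLp.toLp 2 (Pi.single j 1))
  have hM : M * Matrix.of (fun i j => (f j).ofLp i) = 1 := by
    ext i j : 1
    have h1 := congrArg (fun v => v.ofLp i) (hf j)
    rw [Matrix.one_apply, ← Pi.single_apply]
    exact h1
  exact IsUnit.of_mul_eq_one _ hM

/-- The block matrix inequality as the dissipation inequality of the storage function
`⟪-H x, x⟫ / 2`. -/
theorem posSemidef_lyapunov_iff [Fintype m] [DecidableEq n] {H A : Matrix m m ℍ[ℝ]}
    (hH : H.IsHermitian) (B : Matrix m n ℍ[ℝ]) (C : Matrix n m ℍ[ℝ]) (D : Matrix n n ℍ[ℝ]) :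
    PosSemidef (Matrix.fromBlocks H 0 0 1 * Matrix.fromBlocks A B C D +
        (Matrix.fromBlocks A B C D)ᴴ * Matrix.fromBlocks H 0 0 1) ↔
      ∀ x u, 0 ≤ ⟪vecMap H (vecMap A x + vecMap B u), x⟫_ℝ + ⟪vecMap C x + vecMap D u, u⟫_ℝ := by
  obtain ⟨S, hS⟩ : ∃ S : Matrix (m ⊕ n) (m ⊕ n) ℍ[ℝ], S = Matrix.fromBlocks H 0 0 1 := ⟨_, rfl⟩
  obtain ⟨M, hM⟩ : ∃ M : Matrix (m ⊕ n) (m ⊕ n) ℍ[ℝ], M = Matrix.fromBlocks A B C D := ⟨_, rfl⟩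
  rw [← hS, ← hM]
  have hSh : Sᴴ = S := by
    rw [hS, Matrix.fromBlocks_conjTranspose, hH.eq]; simp
  have hherm : (S * M + Mᴴ * S).IsHermitian := by
    rw [Matrix.IsHermitian, Matrix.conjTranspose_add, Matrix.conjTranspose_mul,
      Matrix.conjTranspose_mul, hSh, Matrix.conjTranspose_conjTranspose, add_comm]
  have hq : ∀ w : m ⊕ n → ℍ[ℝ], (star w ⬝ᵥ ((S * M + Mᴴ * S) *ᵥ w)).re =
      2 * (⟪vecMap H (vecMap A (WithLp.toLp 2 (w ∘ Sum.inl)) +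
          vecMap B (WithLp.toLp 2 (w ∘ Sum.inr))),
        WithLp.toLp 2 (w ∘ Sum.inl)⟫_ℝ + ⟪vecMap C (WithLp.toLp 2 (w ∘ Sum.inl)) +
          vecMap D (WithLp.toLp 2 (w ∘ Sum.inr)), WithLp.toLp 2 (w ∘ Sum.inr)⟫_ℝ) := by
    intro w
    have h1 := inner_eq_re_dotProduct (WithLp.toLp 2 w) (vecMap (S * M + Mᴴ * S) (WithLp.toLp 2 w))
    refine h1.symm.trans ?_
    have h2 : ⟪WithLp.toLp 2 w, vecMap (S * M + Mᴴ * S) (WithLp.toLp 2 w)⟫_ℝ =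
        2 * ⟪vecMap S (vecMap M (WithLp.toLp 2 w)), WithLp.toLp 2 w⟫_ℝ := by
      rw [vecMap_add, inner_add_right, vecMap_mul, vecMap_mul, ← inner_vecMap_left,
        real_inner_comm, inner_vecMap_left S, hSh]
      ring
    rw [h2, inner_eq_re_dotProduct, inner_eq_re_dotProduct, inner_eq_re_dotProduct]
    simp only [vecMap_apply, hS, hM, Matrix.fromBlocks_mulVec]
    congr 1
    simp [dotProduct, Fintype.sum_sum_type]
  constructor
  · intro h x u
    have h1 := h.2 (Sum.elim x.ofLp u.ofLp)
    rw [hq] at h1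
    simpa using h1
  · intro h
    refine ⟨hherm, fun w => ?_⟩
    rw [hq]
    exact mul_nonneg zero_le_two (h _ _)

/-- If `P > 0` and `P A + A^* P ≤ 0`, then `(x - A)² + y²` is invertible for `x > 0`. For `v` in
the kernel and `w = (x - A) v`, the inequality at `v` and at `w` bounds `⟪P w, v⟫` from below by
`x ⟪P v, v⟫` and `x ⟪P w, w⟫` from above by `-y² ⟪P w, v⟫`. -/
theorem isUnit_spherePoly_of_dissipative [Fintype m] [DecidableEq m] {A P : Matrix m m ℍ[ℝ]}
    (hP : Pᴴ = P) (hpos : ∀ v, v ≠ 0 → 0 < ⟪vecMap P v, v⟫_ℝ)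
    (hA : ∀ v, ⟪vecMap P (vecMap A v), v⟫_ℝ ≤ 0) {x y : ℝ} (hx : 0 < x) :
    IsUnit (spherePoly A (x, y)) := by
  refine isUnit_of_vecMap_injective fun v hv => ?_
  have hnonneg : ∀ v, 0 ≤ ⟪vecMap P v, v⟫_ℝ := fun v => by
    by_cases h : v = 0
    · simp [h]
    · exact (hpos v h).le
  obtain ⟨w, hw⟩ : ∃ w, w = x • v - vecMap A v := ⟨_, rfl⟩
  have h1 : x • w - vecMap A w + (y * y) • v = 0 := by
    rw [← hv, spherePoly, vecMap_add, vecMap_mul, vecMap_sub, vecMap_smul, vecMap_one, vecMap_smul,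
      vecMap_one, vecMap_sub, vecMap_smul, vecMap_one, ← hw]
  have h2 : vecMap A v = x • v - w := by rw [hw]; abel
  have h3 : vecMap A w = x • w + (y * y) • v := by
    rw [← sub_eq_zero, ← neg_eq_zero, ← h1]; abel
  have h4 := hA v
  have h5 := hA w
  rw [h2, map_sub, map_smul, inner_sub_left, inner_smul_left] at h4
  rw [h3, map_add, map_smul, map_smul, inner_add_left, inner_smul_left, inner_smul_left,
    inner_vecMap_left P v, hP, real_inner_comm (vecMap P w) v] at h5
  simp only [RCLike.conj_to_real] at h4 h5
  have h6 : y * y * ⟪vecMap P w, v⟫_ℝ ≥ y * y * (x * ⟪vecMap P v, v⟫_ℝ) :=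
    mul_le_mul_of_nonneg_left (by linarith) (mul_self_nonneg y)
  have h7 : 0 ≤ y * y * (x * ⟪vecMap P v, v⟫_ℝ) :=
    mul_nonneg (mul_self_nonneg y) (mul_nonneg hx.le (hnonneg v))
  have hw0 : w = 0 := by
    by_contra h
    have := mul_pos hx (hpos w h)
    linarith
  by_contra h
  have := mul_pos hx (hpos v h)
  rw [hw0, map_zero, inner_zero_left] at h4
  linarith

end VecMap

/-! ### Dissipative realizations have positive definite kernels -/

section Realization

variable {N n k : Type*} [Fintype N] [DecidableEq N]

/-- A realization in pointwise terms, with `G = C ⋆ (p - A)^{-⋆}`. -/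
theorem IsRealization.exists_sylvester {φ : ℍ[ℝ] → Matrix n k ℍ[ℝ]} {A : Matrix N N ℍ[ℝ]}
    {B : Matrix N k ℍ[ℝ]} {C : Matrix n N ℍ[ℝ]} {D : Matrix n k ℍ[ℝ]}
    (h : IsRealization φ A B C D) :
    ∃ G : ℍ[ℝ] → Matrix n N ℍ[ℝ], ∀ p ∈ starResolventSet A,
      p • G p - G p * A = C ∧ φ p = D + G p * B ∧ IsSliceAt φ p := by
  obtain ⟨R, hR, hφ⟩ := h
  have hΩ := axiallySymmetric_starResolventSet A
  refine ⟨starMul (fun _ => C) R, fun p hp => ⟨isStarInverse_sylvester hΩ hR C hp, ?_, ?_⟩⟩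
  · rw [hφ p hp, starMul_const_right (isSliceAt_starMul _ _ p)]
  · refine IsSliceAt.congr hΩ (g := fun p => starMul (starMul (fun _ => C) R) (fun _ => B) p + D)
      (fun p hp => ?_) hp ((isSliceAt_starMul _ _ p).add_const D)
    rw [hφ p hp, add_comm]

/-- Both sides solve the same Sylvester equation. -/
theorem kernel_isHermitian [Fintype n] [DecidableEq n] {φ : ℍ[ℝ] → Matrix n n ℍ[ℝ]} {p q : ℍ[ℝ]}
    (hφp : IsSliceAt φ p) (hφq : IsSliceAt φ q) (hp : 0 < p.re) (hq : 0 < q.re) :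
    kernel φ p q = (kernel φ q p)ᴴ := by
  have hentry : ∀ {p q : ℍ[ℝ]}, IsSliceAt φ p → 0 < p.re → 0 < q.re → ∀ i j,
      p * kernel φ p q i j + kernel φ p q i j * star q = φ p i j + star (φ q j i) := by
    intro p q h hp hq i j
    have := congrFun (congrFun (kernel_sylvester h hp hq) i) j
    simpa [Matrix.mul_apply, Matrix.one_apply] using this
  ext i j : 1
  rw [← sub_eq_zero, Matrix.conjTranspose_apply]
  refine quaternion_sylvester_eq_zero (p := p) (s := star q) (by simp; linarith) ?_
  have h1 := hentry hφp hp hq i j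
  have h2 := congrArg star (hentry hφq hq hp j i)
  simp only [star_add, star_mul, star_star] at h2
  rw [mul_sub, sub_mul, ← sub_eq_zero.2 (h1.trans ((add_comm _ _).trans h2.symm))]
  abel

/-- The quaternionic coefficients of a quadratic form in the Gram matrix can be absorbed into the
vectors `ξ`, so positivity of all Gram matrices is a statement about real inner products. -/
theorem posSemidef_gram_iff {ι : Type*} [Fintype ι] [Fintype n]
    (K : ι → ι → Matrix n n ℍ[ℝ]) (hK : ∀ i j, K i j = (K j i)ᴴ) :
    (∀ ξ : ι → n → ℍ[ℝ], PosSemidef (Matrix.of fun i j => star (ξ i) ⬝ᵥ (K i j *ᵥ ξ j))) ↔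
      ∀ ξ : ι → PiLp 2 (fun _ : n => ℍ[ℝ]), 0 ≤ ∑ i, ∑ j, ⟪vecMap (K i j) (ξ j), ξ i⟫_ℝ := by
  have hre : ∀ {κ : Type _} [Fintype κ] (f : κ → ℍ[ℝ]), (∑ i, f i).re = ∑ i, (f i).re :=
    fun f => map_sum (⟨⟨fun q => q.re, rfl⟩, fun _ _ => rfl⟩ : ℍ[ℝ] →+ ℝ) f _
  have hquad : ∀ (ξ : ι → n → ℍ[ℝ]) (v : ι → ℍ[ℝ]),
      (star v ⬝ᵥ ((Matrix.of fun i j => star (ξ i) ⬝ᵥ (K i j *ᵥ ξ j)) *ᵥ v)).re =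
        ∑ i, ∑ j, ⟪vecMap (K i j) (WithLp.toLp 2 fun a => ξ j a * v j),
          WithLp.toLp 2 fun a => ξ i a * v i⟫_ℝ := by
    intro ξ v
    have h1 : star v ⬝ᵥ ((Matrix.of fun i j => star (ξ i) ⬝ᵥ (K i j *ᵥ ξ j)) *ᵥ v) =
        ∑ i, ∑ j, star (fun a => ξ i a * v i) ⬝ᵥ (K i j *ᵥ fun a => ξ j a * v j) := by
      simp only [dotProduct, Matrix.mulVec, Matrix.of_apply, Finset.mul_sum, Finset.sum_mul,
        Pi.star_apply, star_mul, mul_assoc]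
    rw [h1, hre]
    refine Finset.sum_congr rfl fun i _ => ?_
    rw [hre]
    refine Finset.sum_congr rfl fun j _ => ?_
    rw [real_inner_comm, inner_eq_re_dotProduct]
    rfl
  constructor
  · intro h ξ
    have h1 := (h fun i => (ξ i).ofLp).2 (fun _ => 1)
    rw [hquad] at h1
    simpa using h1
  · intro h ξ
    refine ⟨?_, fun v => ?_⟩
    · ext i j : 1
      rw [Matrix.conjTranspose_apply, Matrix.of_apply, Matrix.of_apply, hK j i,
        ← Matrix.star_dotProduct_star, star_star, Matrix.star_mulVec,
        Matrix.conjTranspose_conjTranspose, Matrix.dotProduct_mulVec]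
    · rw [hquad]
      exact h _

/-- A solution `H < 0` of the matrix inequality gives `ℍ₊ ⊆ Ω_A` and positivity of the kernel. -/
theorem posDefKernelOn_of_dissipative [Fintype n] [DecidableEq n] {φ : ℍ[ℝ] → Matrix n n ℍ[ℝ]}
    {A : Matrix N N ℍ[ℝ]} {B : Matrix N n ℍ[ℝ]} {C : Matrix n N ℍ[ℝ]} {D : Matrix n n ℍ[ℝ]}
    (hφ : IsRealization φ A B C D) {H : Matrix N N ℍ[ℝ]} (hH : NegDef H)
    (hblock : PosSemidef (Matrix.fromBlocks H 0 0 1 * Matrix.fromBlocks A B C D +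
        (Matrix.fromBlocks A B C D)ᴴ * Matrix.fromBlocks H 0 0 1)) :
    halfSpace ⊆ starResolventSet A ∧ PosDefKernelOn (kernel φ) halfSpace := by
  rw [posSemidef_lyapunov_iff hH.1] at hblock
  obtain ⟨P, hP⟩ : ∃ P, P = -H := ⟨_, rfl⟩
  have hHP : H = -P := by rw [hP, neg_neg]
  have hPs : Pᴴ = P := by rw [hP, Matrix.conjTranspose_neg, hH.1.eq]
  have hpos : ∀ v, v ≠ 0 → 0 < ⟪vecMap P v, v⟫_ℝ := by
    intro v hv
    have h1 := hH.2 v.ofLp (fun h => hv ((WithLp.ofLp_eq_zero 2).1 h))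
    rw [real_inner_comm, inner_eq_re_dotProduct, hP, vecMap_neg]
    simpa [vecMap_apply] using h1
  have hdiss : ∀ x u, ⟪vecMap P (vecMap A x + vecMap B u), x⟫_ℝ ≤
      ⟪vecMap C x + vecMap D u, u⟫_ℝ := by
    intro x u
    have h1 := hblock x u
    rw [hHP, vecMap_neg, inner_neg_left] at h1
    linarith
  have hA : ∀ v, ⟪vecMap P (vecMap A v), v⟫_ℝ ≤ 0 := by
    intro v
    simpa using hdiss v 0
  have hsub : halfSpace ⊆ starResolventSet A := fun p hp =>
    mem_starResolventSet (isUnit_spherePoly_of_dissipative hPs hpos hA hp)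
  obtain ⟨G, hG⟩ := hφ.exists_sylvester
  have hherm : ∀ p ∈ halfSpace, ∀ q ∈ halfSpace, kernel φ p q = (kernel φ q p)ᴴ :=
    fun p hp q hq => kernel_isHermitian (hG p (hsub hp)).2.2 (hG q (hsub hq)).2.2 hp hq
  refine ⟨hsub, hherm, fun m u ξ hu => ?_⟩
  refine (posSemidef_gram_iff (fun i j => kernel φ (u i) (u j))
    fun i j => hherm _ (hu i) _ (hu j)).2 (fun η => ?_) ξ
  -- The inverse of `P` gives the dual storage function.
  have hinj : Function.Injective (vecMap P) := by
    refine (injective_iff_map_eq_zero _).2 fun v hv => ?_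
    by_contra h
    have := hpos v h
    rw [hv, inner_zero_left] at this
    exact lt_irrefl _ this
  have hPsymm : ∀ v w, ⟪vecMap P v, w⟫_ℝ = ⟪v, vecMap P w⟫_ℝ := fun v w => by
    rw [inner_vecMap_left, hPs]
  let Pe := LinearEquiv.ofInjectiveEndo (vecMap P) hinj
  have hPQ : ∀ v, vecMap P (Pe.symm v) = v := fun v => Pe.apply_symm_apply v
  refine kernel_nonneg_of_dissipative (fun i j => vecMap (kernel φ (u i) (u j)))
    (fun i => vecMap (star (u i) • 1)) (fun i => vecMap (φ (u i))) ?_ ?_ ?_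
    (vecMap A) Pe.symm.toLinearMap (vecMap B) (vecMap C) (vecMap D) (fun i => vecMap (G (u i)))
    (fun i => vecMap (G (u i))ᴴ) (fun i => inner_vecMap_left _) ?_ ?_ ?_ ?_ ?_ η
  · intro i j c d
    rw [inner_vecMap_left, ← hherm _ (hu j) _ (hu i)]
  · intro i j c d
    rw [inner_vecMap_star_smul, ← vecMap_mul, ← inner_add_left, ← vecMap_add,
      kernel_sylvester (hG _ (hsub (hu i))).2.2 (hu i) (hu j), vecMap_add, inner_add_left,
      inner_vecMap_left (φ (u j))ᴴ, Matrix.conjTranspose_conjTranspose]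
  · intro i c hc
    rw [inner_vecMap_star_smul_self]
    exact mul_pos (hu i) (real_inner_self_pos.2 hc)
  · intro i x c
    rw [inner_vecMap_star_smul, ← vecMap_mul, ← inner_sub_left, ← vecMap_sub,
      (hG _ (hsub (hu i))).1]
  · intro i c
    rw [(hG _ (hsub (hu i))).2.1, vecMap_add, vecMap_mul]
  · intro v w
    change ⟪Pe.symm v, w⟫_ℝ = ⟪v, Pe.symm w⟫_ℝ
    rw [← hPQ w, ← hPsymm, hPQ, hPQ]
  · intro v
    change 0 ≤ ⟪Pe.symm v, v⟫_ℝ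
    by_cases h : Pe.symm v = 0
    · rw [h, inner_zero_left]
    · have := hpos _ h
      rw [hPQ, real_inner_comm] at this
      exact this.le
  · intro z w
    change ⟪vecMap A (Pe.symm z), z⟫_ℝ - _ + ⟪vecMap C (Pe.symm z), w⟫_ℝ - _ ≤ 0
    have h1 := hdiss (-Pe.symm z) w
    rw [hPsymm, map_neg, map_neg, map_neg, hPQ, inner_neg_right, inner_add_left, inner_neg_left,
      inner_add_left, inner_neg_left] at h1
    linarith

end Realization

/-! ### Averaging over the quaternion group -/

section Averaging

/-- The quaternion `j`. -/
def unitJ : ℍ[ℝ] := ⟨0, 0, 1, 0⟩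

/-- The quaternion `k`. -/
def unitK : ℍ[ℝ] := ⟨0, 0, 0, 1⟩

theorem unitI_components :
    unitI.re = 0 ∧ unitI.imI = 1 ∧ unitI.imJ = 0 ∧ unitI.imK = 0 := ⟨rfl, rfl, rfl, rfl⟩

theorem unitJ_components :
    unitJ.re = 0 ∧ unitJ.imI = 0 ∧ unitJ.imJ = 1 ∧ unitJ.imK = 0 := ⟨rfl, rfl, rfl, rfl⟩

theorem unitK_components :
    unitK.re = 0 ∧ unitK.imI = 0 ∧ unitK.imJ = 0 ∧ unitK.imK = 1 := ⟨rfl, rfl, rfl, rfl⟩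

/-- A real bilinear form on `ℍ`, averaged over right multiplication by `1, i, j, k`, is
`(s, t) ↦ Re (s̄ c t)` for a quaternion `c`. -/
theorem exists_quaternion_of_average (g : ℍ[ℝ] →ₗ[ℝ] ℍ[ℝ] →ₗ[ℝ] ℝ) :
    ∃ c : ℍ[ℝ], ∀ s t, g s t + g (s * unitI) (t * unitI) + g (s * unitJ) (t * unitJ) +
      g (s * unitK) (t * unitK) = (star s * (c * t)).re := by
  have hdec : ∀ s : ℍ[ℝ], s = s.re • (1 : ℍ[ℝ]) + s.imI • unitI + s.imJ • unitJ +
      s.imK • unitK := by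
    intro s
    ext <;> simp [unitI_components, unitJ_components, unitK_components]
  have hg : ∀ s t, g s t =
      s.re * (t.re * g 1 1 + t.imI * g 1 unitI + t.imJ * g 1 unitJ + t.imK * g 1 unitK) +
      s.imI * (t.re * g unitI 1 + t.imI * g unitI unitI + t.imJ * g unitI unitJ +
        t.imK * g unitI unitK) +
      s.imJ * (t.re * g unitJ 1 + t.imI * g unitJ unitI + t.imJ * g unitJ unitJ +
        t.imK * g unitJ unitK) +
      s.imK * (t.re * g unitK 1 + t.imI * g unitK unitI + t.imJ * g unitK unitJ +
        t.imK * g unitK unitK) := by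
    intro s t
    conv_lhs => rw [hdec s, hdec t]
    simp only [map_add, map_smul, LinearMap.add_apply, LinearMap.smul_apply, smul_eq_mul]
    ring
  -- Comparison of coefficients at `s = 1` determines `c`.
  obtain ⟨c, hc0, hc1, hc2, hc3⟩ : ∃ c : ℍ[ℝ],
      c.re = g 1 1 + g unitI unitI + g unitJ unitJ + g unitK unitK ∧
      c.imI = -(g 1 unitI - g unitI 1 + g unitJ unitK - g unitK unitJ) ∧
      c.imJ = -(g 1 unitJ - g unitI unitK - g unitJ 1 + g unitK unitI) ∧
      c.imK = -(g 1 unitK + g unitI unitJ - g unitJ unitI - g unitK 1) :=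
    ⟨⟨_, _, _, _⟩, rfl, rfl, rfl, rfl⟩
  refine ⟨c, fun s t => ?_⟩
  rw [hg s t, hg (s * unitI), hg (s * unitJ), hg (s * unitK)]
  have hI : ∀ s : ℍ[ℝ], (s * unitI).re = -s.imI ∧ (s * unitI).imI = s.re ∧
      (s * unitI).imJ = s.imK ∧ (s * unitI).imK = -s.imJ := fun s => by simp [unitI_components]
  have hJ : ∀ s : ℍ[ℝ], (s * unitJ).re = -s.imJ ∧ (s * unitJ).imI = -s.imK ∧
      (s * unitJ).imJ = s.re ∧ (s * unitJ).imK = s.imI := fun s => by simp [unitJ_components]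
  have hK : ∀ s : ℍ[ℝ], (s * unitK).re = -s.imK ∧ (s * unitK).imI = s.imJ ∧
      (s * unitK).imJ = -s.imI ∧ (s * unitK).imK = s.re := fun s => by simp [unitK_components]
  simp only [hI, hJ, hK, Quaternion.re_mul, Quaternion.imI_mul, Quaternion.imJ_mul,
    Quaternion.imK_mul, Quaternion.re_star, Quaternion.imI_star, Quaternion.imJ_star,
    Quaternion.imK_star, hc0, hc1, hc2, hc3]
  ring

variable {m n : Type*} [Fintype n]

/-- Right multiplication of all entries of a vector by the quaternion `e`. -/
noncomputable def rightMul (e : ℍ[ℝ]) :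
    PiLp 2 (fun _ : n => ℍ[ℝ]) →ₗ[ℝ] PiLp 2 (fun _ : n => ℍ[ℝ]) where
  toFun v := WithLp.toLp 2 fun i => v i * e
  map_add' v w := by ext i : 1; simp [add_mul]
  map_smul' r v := by ext i : 1; simp

theorem vecMap_rightMul [Fintype m] (M : Matrix m n ℍ[ℝ]) (e : ℍ[ℝ])
    (v : PiLp 2 (fun _ : n => ℍ[ℝ])) : vecMap M (rightMul e v) = rightMul e (vecMap M v) := by
  ext i : 1
  change ∑ j, M i j * (v j * e) = (∑ j, M i j * v j) * e
  simp only [Finset.sum_mul, mul_assoc]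

/-- A real bilinear form, averaged over the quaternion group, is the form of a quaternionic
matrix. -/
theorem exists_matrix_of_average [DecidableEq n]
    (b : PiLp 2 (fun _ : n => ℍ[ℝ]) →ₗ[ℝ] PiLp 2 (fun _ : n => ℍ[ℝ]) →ₗ[ℝ] ℝ) :
    ∃ P : Matrix n n ℍ[ℝ], ∀ x y, b x y + b (rightMul unitI x) (rightMul unitI y) +
      b (rightMul unitJ x) (rightMul unitJ y) + b (rightMul unitK x) (rightMul unitK y) =
        ⟪x, vecMap P y⟫_ℝ := by
  let δ : n → ℍ[ℝ] →ₗ[ℝ] PiLp 2 (fun _ : n => ℍ[ℝ]) := fun i =>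
    { toFun := fun s => WithLp.toLp 2 (Pi.single i s)
      map_add' := fun s t => by rw [Pi.single_add]; rfl
      map_smul' := fun r s => by rw [Pi.single_smul]; rfl }
  have hδ : ∀ x : PiLp 2 (fun _ : n => ℍ[ℝ]), x = ∑ i, δ i (x i) := by
    intro x
    ext a : 1
    rw [WithLp.ofLp_sum, Finset.sum_apply]
    simp [δ]
  have hδe : ∀ e i s, rightMul e (δ i s) = δ i (s * e) := by
    intro e i s
    ext a : 1
    change (Pi.single i s : n → ℍ[ℝ]) a * e = (Pi.single i (s * e) : n → ℍ[ℝ]) a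
    by_cases h : a = i
    · subst h; simp
    · simp [h]
  choose c hc using fun i j => exists_quaternion_of_average (b.compl₁₂ (δ i) (δ j))
  refine ⟨Matrix.of c, fun x y => ?_⟩
  have hre : ∀ f : n → ℍ[ℝ], (∑ i, f i).re = ∑ i, (f i).re := fun f =>
    map_sum (⟨⟨fun q => q.re, rfl⟩, fun _ _ => rfl⟩ : ℍ[ℝ] →+ ℝ) f _
  have hr : ⟪x, vecMap (Matrix.of c) y⟫_ℝ = ∑ i, ∑ j, (star (x i) * (c i j * y j)).re := by
    rw [inner_eq_re_dotProduct]
    simp only [vecMap_apply, dotProduct, Matrix.mulVec, Finset.mul_sum, Matrix.of_apply, hre,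
      Pi.star_apply]
  have hexp : ∀ e, b (rightMul e x) (rightMul e y) =
      ∑ i, ∑ j, b (δ i (x i * e)) (δ j (y j * e)) := by
    intro e
    conv_lhs => rw [hδ x, hδ y]
    simp only [map_sum, LinearMap.sum_apply, hδe]
    exact Finset.sum_comm
  have h1 : b x y = ∑ i, ∑ j, b (δ i (x i)) (δ j (y j)) := by
    have h := hexp 1
    simpa [rightMul] using h
  rw [hr, h1, hexp, hexp, hexp]
  simp only [← Finset.sum_add_distrib, ← hc, LinearMap.compl₁₂_apply]

end Averaging

/-! ### Controllability, observability and the storage form -/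

section Necessity

attribute [local instance] Matrix.linftyOpNormedRing Matrix.linftyOpNormedAlgebra

variable {N n : Type*}

theorem inner_rightMul [Fintype n] (e : ℍ[ℝ]) (v w : PiLp 2 (fun _ : n => ℍ[ℝ])) :
    ⟪rightMul e v, rightMul e w⟫_ℝ = Quaternion.normSq e * ⟪v, w⟫_ℝ := by
  rw [PiLp.inner_apply, PiLp.inner_apply, Finset.mul_sum]
  refine Finset.sum_congr rfl fun i _ => ?_
  change ⟪v i * e, w i * e⟫_ℝ = _
  rw [Quaternion.inner_def, Quaternion.inner_def, star_mul, mul_assoc, ← mul_assoc e,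
    Quaternion.self_mul_star, Quaternion.coe_mul_eq_smul, mul_smul_comm]
  rfl

theorem vecMap_injective [Fintype n] [DecidableEq n] {M M' : Matrix N n ℍ[ℝ]}
    (h : ∀ v, vecMap M v = vecMap M' v) : M = M' := by
  ext i j : 1
  have := congrArg (fun v => v.ofLp i) (h (WithLp.toLp 2 (Pi.single j 1)))
  simpa [vecMap_apply] using this

theorem continuous_vecMap_mul [Fintype N] [Fintype n] [DecidableEq N] (C : Matrix n N ℍ[ℝ])
    (x : PiLp 2 (fun _ : N => ℍ[ℝ])) :
    Continuous fun M : Matrix N N ℍ[ℝ] => vecMap (C * M) x := by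
  let f : Matrix N N ℍ[ℝ] →ₗ[ℝ] PiLp 2 (fun _ : n => ℍ[ℝ]) :=
    { toFun := fun M => vecMap (C * M) x
      map_add' := fun M M' => by rw [Matrix.mul_add, vecMap_add]
      map_smul' := fun r M => by rw [Matrix.mul_smul, vecMap_smul]; rfl }
  exact f.continuous_of_finiteDimensional

/-- At a real point the Sylvester equation `t G - G A = C` involves only the ordinary resolvent. -/
theorem real_sylvester_eq [Fintype N] [DecidableEq N]
    {A : Matrix N N ℍ[ℝ]} {C G : Matrix n N ℍ[ℝ]} {t : ℝ}
    (ht : IsUnit (t • (1 : Matrix N N ℍ[ℝ]) - A)) (h : (t : ℍ[ℝ]) • G - G * A = C) :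
    G = C * resolvent A t := by
  rw [coe_smul_matrix] at h
  have h1 : G * (t • (1 : Matrix N N ℍ[ℝ]) - A) = C := by
    rw [Matrix.mul_sub, Matrix.mul_smul, Matrix.mul_one, h]
  rw [resolvent, Algebra.algebraMap_eq_smul_one, ← h1, Matrix.mul_assoc,
    Ring.mul_inverse_cancel _ ht, Matrix.mul_one]

theorem isUnit_smul_one_sub [Fintype N] [DecidableEq N] {A : Matrix N N ℍ[ℝ]} {t : ℝ}
    (h : ‖A‖ * ‖(1 : Matrix N N ℍ[ℝ])‖ < t) : IsUnit (t • (1 : Matrix N N ℍ[ℝ]) - A) := by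
  have := spectrum.mem_resolventSet_of_norm_lt_mul (𝕜 := ℝ) (a := A) (k := t)
    (h.trans_le (le_abs_self t))
  rwa [spectrum.mem_resolventSet_iff, Algebra.algebraMap_eq_smul_one] at this

/-- A subspace that contains the range of `R B` and is invariant under `R = (a - A)⁻¹` is
invariant under `A`, hence contains the ranges of all `A ^ t B`. By controllability it is the
whole space. -/
theorem eq_top_of_controllable [Fintype N] [Fintype n] [DecidableEq N]
    {C : Matrix n N ℍ[ℝ]} {A R : Matrix N N ℍ[ℝ]} {B : Matrix N n ℍ[ℝ]}
    (hmin : IsMinimal C A B) {a : ℝ} (hR : (a • 1 - A) * R = 1)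
    (S : Submodule ℝ (PiLp 2 (fun _ : N => ℍ[ℝ]))) (hB : ∀ u, vecMap R (vecMap B u) ∈ S)
    (hS : ∀ x ∈ S, vecMap R x ∈ S) : S = ⊤ := by
  have hRR : ∀ x, a • vecMap R x - vecMap A (vecMap R x) = x := by
    intro x
    have h := congrArg (fun M => vecMap M x) hR
    simp only [vecMap_mul, vecMap_sub, vecMap_smul, vecMap_one] at h
    exact h
  have hA : ∀ x ∈ S, vecMap A x ∈ S := by
    intro x hx
    -- `R` restricts to an injective, hence surjective, map of `S`.
    have hinj : Function.Injective ((vecMap R).restrict hS) := by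
      refine (injective_iff_map_eq_zero _).2 fun y hy => ?_
      have h1 : vecMap R y = 0 := congrArg Subtype.val hy
      have h2 := hRR y
      rw [h1, map_zero, smul_zero, sub_zero] at h2
      exact Subtype.ext h2.symm
    obtain ⟨y, hy⟩ := LinearMap.injective_iff_surjective.1 hinj ⟨x, hx⟩
    have hy' : vecMap R y = x := congrArg Subtype.val hy
    have h2 := hRR y
    rw [hy'] at h2
    have h3 : vecMap A x = a • x - y := by rw [← h2]; abel
    rw [h3]
    exact S.sub_mem (S.smul_mem _ hx) y.2
  have hAB : ∀ t u, vecMap (A ^ t * B) u ∈ S := by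
    intro t u
    induction t with
    | zero =>
      rw [pow_zero, Matrix.one_mul, ← hRR (vecMap B u)]
      exact S.sub_mem (S.smul_mem _ (hB u)) (hA _ (hB u))
    | succ t ih =>
      rw [pow_succ', Matrix.mul_assoc, vecMap_mul]
      exact hA _ ih
  rw [← Submodule.orthogonal_eq_bot_iff, Submodule.eq_bot_iff]
  intro v hv
  refine (WithLp.ofLp_eq_zero 2).1 (hmin.controllable v.ofLp fun t => ?_)
  have h1 : vecMap (A ^ t * B)ᴴ v = 0 := by
    refine ext_inner_left ℝ fun u => ?_
    rw [← inner_vecMap_left, inner_zero_right]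
    exact (Submodule.mem_orthogonal S v).1 hv _ (hAB t u)
  rw [Matrix.conjTranspose_mul, Matrix.conjTranspose_pow] at h1
  exact congrArg WithLp.ofLp h1

/-- If `C (t - A)⁻¹ x = 0` for all large real `t`, then also `C (t - A)⁻¹ A x = -C x`. As the
left side tends to `0`, `C x = 0`, and `A x` has the same property as `x`. By observability
`x = 0`. -/
theorem eq_zero_of_observable [Fintype N] [Fintype n] [DecidableEq N]
    {C : Matrix n N ℍ[ℝ]} {A : Matrix N N ℍ[ℝ]} {B : Matrix N n ℍ[ℝ]}
    (hmin : IsMinimal C A B) {x : PiLp 2 (fun _ : N => ℍ[ℝ])} {r : ℝ}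
    (hr : ‖A‖ * ‖(1 : Matrix N N ℍ[ℝ])‖ ≤ r)
    (hx : ∀ t : ℝ, r < t → vecMap (C * resolvent A t) x = 0) : x = 0 := by
  have hstep : ∀ x : PiLp 2 (fun _ : N => ℍ[ℝ]),
      (∀ t : ℝ, r < t → vecMap (C * resolvent A t) x = 0) →
      vecMap C x = 0 ∧ ∀ t : ℝ, r < t → vecMap (C * resolvent A t) (vecMap A x) = 0 := by
    intro x hx
    have h1 : ∀ t : ℝ, r < t → vecMap (C * resolvent A t) (vecMap A x) = -vecMap C x := by
      intro t ht
      have h2 : C * resolvent A t * (t • 1 - A) = C := by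
        rw [resolvent, Algebra.algebraMap_eq_smul_one, Matrix.mul_assoc,
          Ring.inverse_mul_cancel _ (isUnit_smul_one_sub (hr.trans_lt ht)), Matrix.mul_one]
      have h3 := congrArg (fun M => vecMap M x) h2
      simp only [vecMap_mul _ (_ - _), vecMap_sub, vecMap_smul, vecMap_one, map_sub, map_smul,
        hx t ht] at h3
      rw [← h3]
      simp
    have hlim : Tendsto (fun t : ℝ => vecMap (C * resolvent A t) (vecMap A x)) atTop (𝓝 0) := by
      have h4 := (spectrum.resolvent_tendsto_cobounded (𝕜 := ℝ) A).mono_left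
        IsOrderBornology.atTop_le_cobounded
      have h5 := ((continuous_vecMap_mul C (vecMap A x)).tendsto 0).comp h4
      have h6 : vecMap (C * (0 : Matrix N N ℍ[ℝ])) (vecMap A x) = 0 := by simp [vecMap_apply]
      rw [h6] at h5
      exact h5
    have hC : vecMap C x = 0 := by
      have h6 : Tendsto (fun t : ℝ => vecMap (C * resolvent A t) (vecMap A x)) atTop
          (𝓝 (-vecMap C x)) :=
        tendsto_const_nhds.congr' (by
          filter_upwards [eventually_gt_atTop r] with t ht
          exact (h1 t ht).symm)
      exact neg_eq_zero.1 (tendsto_nhds_unique h6 hlim)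
    exact ⟨hC, fun t ht => by rw [h1 t ht, hC, neg_zero]⟩
  have hpow : ∀ k : ℕ, ∀ t : ℝ, r < t → vecMap (C * resolvent A t) (vecMap (A ^ k) x) = 0 := by
    intro k
    induction k with
    | zero => simpa [vecMap_one] using hx
    | succ k ih =>
      rw [pow_succ', vecMap_mul]
      exact (hstep _ ih).2
  refine (WithLp.ofLp_eq_zero 2).1 (hmin.observable x.ofLp fun k => ?_)
  have := (hstep _ (hpow k)).1
  rw [← vecMap_mul] at this
  exact congrArg WithLp.ofLp this

/-- A real storage form can be replaced by a quaternionic one. -/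
theorem exists_negDef_of_storage [Fintype N] [Fintype n] [DecidableEq N] [DecidableEq n]
    {A : Matrix N N ℍ[ℝ]} {B : Matrix N n ℍ[ℝ]} {C : Matrix n N ℍ[ℝ]} {D : Matrix n n ℍ[ℝ]}
    (b : PiLp 2 (fun _ : N => ℍ[ℝ]) →ₗ[ℝ] PiLp 2 (fun _ : N => ℍ[ℝ]) →ₗ[ℝ] ℝ)
    (hb : ∀ x y, b x y = b y x) (hpos : ∀ x, x ≠ 0 → 0 < b x x)
    (hdiss : ∀ x u, b (vecMap A x + vecMap B u) x ≤ ⟪vecMap C x + vecMap D u, u⟫_ℝ) :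
    ∃ H : Matrix N N ℍ[ℝ], NegDef H ∧
      PosSemidef (Matrix.fromBlocks H 0 0 1 * Matrix.fromBlocks A B C D +
        (Matrix.fromBlocks A B C D)ᴴ * Matrix.fromBlocks H 0 0 1) := by
  obtain ⟨P, hP⟩ := exists_matrix_of_average b
  have hPh : Pᴴ = P := by
    refine vecMap_injective fun y => ext_inner_left ℝ fun x => ?_
    rw [← inner_vecMap_left, real_inner_comm, ← hP, ← hP, hb x y, hb (rightMul unitI x),
      hb (rightMul unitJ x), hb (rightMul unitK x)]
  have hnonneg : ∀ x, 0 ≤ b x x := fun x => by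
    by_cases h : x = 0
    · simp [h]
    · exact (hpos x h).le
  -- `P` is the sum, not the mean, of four forms; the block inequality has the identity in its
  -- lower right corner and fixes the scale, hence the factor `1 / 4`.
  have hH : ((-(1 / 4 : ℝ)) • P).IsHermitian := by
    ext i j : 1
    rw [Matrix.conjTranspose_apply, Matrix.smul_apply, Matrix.smul_apply, Quaternion.star_smul,
      ← Matrix.conjTranspose_apply, hPh]
  refine ⟨(-(1 / 4 : ℝ)) • P, ⟨hH, fun v hv => ?_⟩,
    (posSemidef_lyapunov_iff hH B C D).2 fun x u => ?_⟩
  · have h1 := inner_eq_re_dotProduct (WithLp.toLp 2 v)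
      (vecMap ((-(1 / 4 : ℝ)) • P) (WithLp.toLp 2 v))
    refine (h1.symm.trans_lt ?_)
    rw [vecMap_smul, inner_smul_right, ← hP]
    have := hpos (WithLp.toLp 2 v) (fun h => hv ((WithLp.toLp_eq_zero 2).1 h))
    have h2 := hnonneg (rightMul unitI (WithLp.toLp 2 v))
    have h3 := hnonneg (rightMul unitJ (WithLp.toLp 2 v))
    have h4 := hnonneg (rightMul unitK (WithLp.toLp 2 v))
    linarith
  · rw [vecMap_smul, inner_smul_left, inner_vecMap_left, hPh, ← hP, RCLike.conj_to_real]
    have h0 := hdiss x u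
    have hr : ∀ e : ℍ[ℝ], Quaternion.normSq e = 1 →
        b (rightMul e (vecMap A x + vecMap B u)) (rightMul e x) ≤
          ⟪vecMap C x + vecMap D u, u⟫_ℝ := by
      intro e he
      have h := hdiss (rightMul e x) (rightMul e u)
      simp only [vecMap_rightMul, ← map_add, inner_rightMul, he, one_mul] at h
      exact h
    have h1 := hr unitI (by simp [Quaternion.normSq_def', unitI_components])
    have h2 := hr unitJ (by simp [Quaternion.normSq_def', unitJ_components])
    have h3 := hr unitK (by simp [Quaternion.normSq_def', unitK_components])
    linarith

end Necessity

/-! ### Realizations of positive definite kernels are dissipative -/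

section Necessity

attribute [local instance] Matrix.linftyOpNormedRing Matrix.linftyOpNormedAlgebra

/-- A positive definite quaternionic kernel on `Ω` as an operator-valued positive semidefinite
matrix over the real Hilbert space of quaternionic vectors. -/
theorem PosDefKernelOn.posSemidef {n : Type*} [Fintype n]
    {K : ℍ[ℝ] → ℍ[ℝ] → Matrix n n ℍ[ℝ]} {Ω : Set ℍ[ℝ]} (h : PosDefKernelOn K Ω) :
    (Matrix.of fun p q : Ω => LinearMap.toContinuousLinearMap (vecMap (K p q))).PosSemidef := by
  have htfae := (posSemidef_tfae (K := Matrix.of fun p q : Ω =>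
    LinearMap.toContinuousLinearMap (vecMap (K p q)))).out 2 0
  refine htfae.1 ⟨?_, fun vv => ?_⟩
  · ext p q : 1
    rw [Matrix.conjTranspose_apply, ContinuousLinearMap.star_eq_adjoint]
    refine ((ContinuousLinearMap.eq_adjoint_iff _ _).2 fun x y => ?_).symm
    change ⟪vecMap (K p q) x, y⟫_ℝ = ⟪x, vecMap (K q p) y⟫_ℝ
    rw [inner_vecMap_left, ← h.1 _ q.2 _ p.2]
  · let e := vv.support.equivFin
    have h1 := (posSemidef_gram_iff (fun i j => K (e.symm i).1 (e.symm j).1)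
      fun i j => h.1 _ (e.symm i).1.2 _ (e.symm j).1.2).1
      (fun ξ => h.2 _ (fun i => (e.symm i).1) ξ fun i => (e.symm i).1.2)
      (fun i => vv (e.symm i).1)
    refine h1.trans_eq ?_
    have hsum : ∀ f : Ω → ℝ, ∑ i, f (e.symm i).1 = ∑ p ∈ vv.support, f p := fun f => by
      rw [← Finset.sum_coe_sort vv.support, ← e.symm.sum_comp]
    rw [Finset.sum_comm]
    exact (Finset.sum_congr rfl fun i _ => hsum fun p =>
      ⟪vecMap (K p (e.symm i).1) (vv (e.symm i).1), vv p⟫_ℝ).trans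
      (hsum fun q => ∑ p ∈ vv.support, ⟪vecMap (K p q) (vv q), vv p⟫_ℝ)

/-- A kernel that is positive definite on `ℍ₊ ∩ Ω_A` yields a solution of the matrix
inequality. All large real points lie in this set, and `exists_storage` is applied at one of
them. -/
theorem exists_negDef_of_posDefKernelOn {n N : ℕ}
    {A : Matrix (Fin N) (Fin N) ℍ[ℝ]} {B : Matrix (Fin N) (Fin n) ℍ[ℝ]}
    {C : Matrix (Fin n) (Fin N) ℍ[ℝ]} {D : Matrix (Fin n) (Fin n) ℍ[ℝ]}
    {φ : ℍ[ℝ] → Matrix (Fin n) (Fin n) ℍ[ℝ]}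
    (hφ : IsRealization φ A B C D) (hmin : IsMinimal C A B)
    (hK : PosDefKernelOn (kernel φ) (halfSpace ∩ starResolventSet A)) :
    ∃ H : Matrix (Fin N) (Fin N) ℍ[ℝ], NegDef H ∧
      PosSemidef (Matrix.fromBlocks H 0 0 1 * Matrix.fromBlocks A B C D +
        (Matrix.fromBlocks A B C D)ᴴ * Matrix.fromBlocks H 0 0 1) := by
  obtain ⟨G, hG⟩ := hφ.exists_sylvester
  obtain ⟨Ω, hΩ⟩ : ∃ Ω, Ω = halfSpace ∩ starResolventSet A := ⟨_, rfl⟩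
  rw [← hΩ] at hK
  have hre : ∀ p : Ω, 0 < (p : ℍ[ℝ]).re := fun p => (hΩ.subset p.2).1
  have hres : ∀ p : Ω, (p : ℍ[ℝ]) ∈ starResolventSet A :=
    fun p => (hΩ.subset p.2).2
  obtain ⟨r, hr⟩ : ∃ r, r = ‖A‖ * ‖(1 : Matrix (Fin N) (Fin N) ℍ[ℝ])‖ := ⟨_, rfl⟩
  have hr0 : 0 ≤ r := by rw [hr]; positivity
  have hunit : ∀ t : ℝ, r < t → IsUnit (t • (1 : Matrix (Fin N) (Fin N) ℍ[ℝ]) - A) :=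
    fun t ht => isUnit_smul_one_sub (hr ▸ ht)
  have hmem : ∀ t : ℝ, r < t → (t : ℍ[ℝ]) ∈ Ω := by
    intro t ht
    rw [hΩ]
    exact ⟨by simpa [halfSpace] using hr0.trans_lt ht, coe_mem_starResolventSet (hunit t ht)⟩
  have hGt : ∀ t : ℝ, r < t → G t = C * resolvent A t := fun t ht =>
    real_sylvester_eq (hunit t ht) (hG _ (hres ⟨_, hmem t ht⟩)).1
  -- The reproducing kernel Hilbert space of the kernel.
  obtain ⟨Kop, hKop⟩ : ∃ Kop : Matrix Ω Ω (PiLp 2 (fun _ : Fin n => ℍ[ℝ]) →L[ℝ]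
      PiLp 2 (fun _ : Fin n => ℍ[ℝ])), Kop = Matrix.of fun p q : Ω =>
        LinearMap.toContinuousLinearMap (vecMap (kernel φ p q)) := ⟨_, rfl⟩
  have : Fact Kop.PosSemidef := ⟨hKop ▸ hK.posSemidef⟩
  have hinner : ∀ (p q : Ω) c d, ⟪kerFun (OfKernel Kop) q c, kerFun (OfKernel Kop) p d⟫_ℝ =
      ⟪vecMap (kernel φ p q) c, d⟫_ℝ := by
    intro p q c d
    rw [← kernel_inner, OfKernel.kernel_ofKernel, hKop]
    rfl
  let a := r + 1
  have ha : r < a := lt_add_one r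
  have ha0 : 0 < a := hr0.trans_lt ha
  let o : Ω := ⟨(a : ℝ), hmem a ha⟩
  let L : Ω → PiLp 2 (fun _ : Fin n => ℍ[ℝ]) →ₗ[ℝ] PiLp 2 (fun _ : Fin n => ℍ[ℝ]) :=
    fun q => vecMap (star (q : ℍ[ℝ]) • 1)
  have hLt : ∀ (q : Ω) (t : ℝ), (q : ℍ[ℝ]) = t → ∀ c, L q c = t • c := by
    intro q t hq c
    change vecMap (star (q : ℍ[ℝ]) • 1) c = _
    rw [hq, Quaternion.star_coe, coe_smul_matrix, vecMap_smul, vecMap_one]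
  have hKL : ∀ p q c d, ⟪kerFun (OfKernel Kop) q (L q c), kerFun (OfKernel Kop) p d⟫_ℝ +
      ⟪kerFun (OfKernel Kop) q c, kerFun (OfKernel Kop) p (L p d)⟫_ℝ =
        ⟪vecMap (φ p) c, d⟫_ℝ + ⟪c, vecMap (φ q) d⟫_ℝ := by
    intro p q c d
    rw [hinner, hinner, inner_vecMap_star_smul, ← vecMap_mul, add_comm, ← inner_add_left,
      ← vecMap_add, kernel_sylvester (hG _ (hres p)).2.2 (hre p) (hre q), vecMap_add,
      inner_add_left, inner_vecMap_left (φ q)ᴴ, Matrix.conjTranspose_conjTranspose]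
  -- Points of the positive real axis approximating `a`.
  have hsr : ∀ m : ℕ, r < a + 1 / ((m : ℝ) + 1) := fun m => by
    have : 0 < 1 / ((m : ℝ) + 1) := by positivity
    linarith
  let s : ℕ → Ω := fun m => ⟨((a + 1 / ((m : ℝ) + 1) : ℝ) : ℍ[ℝ]), hmem _ (hsr m)⟩
  have hslim : Tendsto (fun m : ℕ => a + 1 / ((m : ℝ) + 1)) atTop (𝓝 a) := by
    simpa using tendsto_const_nhds.add (tendsto_one_div_add_atTop_nhds_zero_nat (𝕜 := ℝ))
  have hsG : ∀ x, Tendsto (fun m => vecMap (G (s m)) x) atTop (𝓝 (vecMap (G o) x)) := by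
    intro x
    have h1 : ContinuousAt (fun t : ℝ => resolvent A t) a := by
      obtain ⟨u, hu⟩ := hunit a ha
      have h2 := NormedRing.inverse_continuousAt u
      rw [hu] at h2
      have h3 : Continuous fun t : ℝ => t • (1 : Matrix (Fin N) (Fin N) ℍ[ℝ]) - A := by fun_prop
      have h4 := ContinuousAt.comp (f := fun t : ℝ => t • (1 : Matrix (Fin N) (Fin N) ℍ[ℝ]) - A)
        h2 h3.continuousAt
      have h5 : (fun t : ℝ => resolvent A t) =
          Ring.inverse ∘ fun t : ℝ => t • (1 : Matrix (Fin N) (Fin N) ℍ[ℝ]) - A :=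
        funext fun t => by simp [resolvent, Algebra.algebraMap_eq_smul_one]
      rw [h5]
      exact h4
    have h5 := (((continuous_vecMap_mul C x).continuousAt).tendsto.comp h1.tendsto).comp hslim
    rw [← hGt a ha] at h5
    refine h5.congr fun m => ?_
    simp only [Function.comp_apply]
    rw [← hGt _ (hsr m)]
  have hsφ : ∀ c, Tendsto (fun m => vecMap (φ (s m)) c) atTop (𝓝 (vecMap (φ o) c)) := by
    intro c
    have h1 := (tendsto_const_nhds (x := vecMap D c)).add (hsG (vecMap B c))
    have h2 : ∀ q : Ω, vecMap (φ q) c = vecMap D c + vecMap (G q) (vecMap B c) := fun q => by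
      rw [(hG _ (hres q)).2.1, vecMap_add, vecMap_mul]
    simp only [h2]
    exact h1
  have hreal : ∀ (p q : Ω) (t t' : ℝ), (p : ℍ[ℝ]) = t → (q : ℍ[ℝ]) = t' → 0 < t → 0 < t' → ∀ c,
      ⟪kerFun (OfKernel Kop) q c, kerFun (OfKernel Kop) p c⟫_ℝ =
        (⟪vecMap (φ p) c, c⟫_ℝ + ⟪vecMap (φ q) c, c⟫_ℝ) / (t + t') := by
    intro p q t t' hp hq ht ht' c
    have h1 := hKL p q c c
    rw [hLt p t hp, hLt q t' hq, map_smul, map_smul, inner_smul_left, inner_smul_right,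
      RCLike.conj_to_real, real_inner_comm (vecMap (φ q) c)] at h1
    rw [eq_div_iff (by positivity)]
    linarith
  -- On the positive axis the kernel is `(φ(t) + φ(t')^*) / (t + t')`, which gives continuity.
  have hsK : ∀ c, Tendsto (fun m => kerFun (OfKernel Kop) (s m) c) atTop
      (𝓝 (kerFun (OfKernel Kop) o c)) := by
    intro c
    rw [tendsto_iff_norm_sub_tendsto_zero]
    have hsq : Tendsto (fun m => ‖kerFun (OfKernel Kop) (s m) c - kerFun (OfKernel Kop) o c‖ ^ 2)
        atTop (𝓝 0) := by
      have hf : Tendsto (fun m => ⟪vecMap (φ (s m)) c, c⟫_ℝ) atTop (𝓝 ⟪vecMap (φ o) c, c⟫_ℝ) :=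
        (hsφ c).inner tendsto_const_nhds
      have hpos : ∀ m : ℕ, 0 < a + 1 / ((m : ℝ) + 1) := fun m => hr0.trans_lt (hsr m)
      have hlim := (((hf.add hf).div (hslim.add hslim) (add_pos ha0 ha0).ne').sub
        (((hf.add (tendsto_const_nhds (x := ⟪vecMap (φ o) c, c⟫_ℝ))).div
          (hslim.add (tendsto_const_nhds (x := a)))
          (add_pos ha0 ha0).ne').const_mul 2)).add
        (tendsto_const_nhds (x := (⟪vecMap (φ o) c, c⟫_ℝ + ⟪vecMap (φ o) c, c⟫_ℝ) / (a + a)))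
      have hzero : ∀ z : ℝ, z - 2 * z + z = 0 := fun z => by ring
      rw [hzero] at hlim
      refine hlim.congr fun m => ?_
      rw [norm_sub_sq_real, ← real_inner_self_eq_norm_sq, ← real_inner_self_eq_norm_sq,
        hreal (s m) (s m) _ _ rfl rfl (hpos m) (hpos m), hreal o o a a rfl rfl ha0 ha0,
        real_inner_comm (kerFun (OfKernel Kop) o c), hreal (s m) o _ a rfl rfl (hpos m) ha0]
      rfl
    have := hsq.sqrt
    simpa using this
  have hL : ∀ q, q ≠ o → ∀ c, ∃ d, L q d - a • d = c := by
    intro q hq c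
    have h0 : star (q : ℍ[ℝ]) - (a : ℝ) ≠ 0 := by
      intro h
      refine hq (Subtype.ext ?_)
      have h1 := congrArg star (sub_eq_zero.1 h)
      rwa [star_star, Quaternion.star_coe] at h1
    refine ⟨vecMap ((star (q : ℍ[ℝ]) - (a : ℝ))⁻¹ • 1) c, ?_⟩
    change vecMap (star (q : ℍ[ℝ]) • 1) _ - _ = _
    rw [← vecMap_mul, ← vecMap_smul, ← vecMap_sub, ← coe_smul_matrix, smul_mul_assoc, one_mul,
      ← sub_smul, smul_smul, mul_inv_cancel₀ h0, one_smul, vecMap_one]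
  obtain ⟨R, hR⟩ : ∃ R, R = resolvent A a := ⟨_, rfl⟩
  have hR1 : (a • 1 - A) * R = 1 := by
    rw [hR, resolvent, Algebra.algebraMap_eq_smul_one, Ring.mul_inverse_cancel _ (hunit a ha)]
  have hR2 : R * (a • 1 - A) = 1 := by
    rw [hR, resolvent, Algebra.algebraMap_eq_smul_one, Ring.inverse_mul_cancel _ (hunit a ha)]
  obtain ⟨V, hV, hVd⟩ := exists_storage (H := OfKernel Kop) L (fun q : Ω => vecMap (φ q)) o a ha0
    (hLt o a rfl) hKL hL (vecMap A) (vecMap R) (vecMap B) (vecMap C) (vecMap D)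
    (fun q : Ω => vecMap (G q))
    (fun q x c => by
      rw [inner_vecMap_star_smul, ← vecMap_mul, ← inner_sub_left, ← vecMap_sub, (hG _ (hres q)).1])
    (fun q u => by rw [(hG _ (hres q)).2.1, vecMap_add, vecMap_mul])
    (fun x => by
      rw [← vecMap_mul, ← vecMap_smul, ← vecMap_sub, ← smul_one_mul a R, ← Matrix.sub_mul, hR1,
        vecMap_one])
    (fun x => by
      have h := congrArg (fun M => vecMap M x) hR2
      simpa only [vecMap_mul, vecMap_sub, vecMap_smul, vecMap_one] using h)
    (fun S hB hS => eq_top_of_controllable hmin hR1 S hB hS) s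
    (fun m h => by
      have h1 := congrArg (fun q : Ω => (q : ℍ[ℝ]).re) h
      have h2 : 0 < 1 / ((m : ℝ) + 1) := by positivity
      simp only [s, o, Quaternion.re_coe] at h1
      linarith) hsK hsG
  refine exists_negDef_of_storage ((innerₗ (OfKernel Kop)).compl₁₂ V V) (fun x y => ?_)
    (fun x hx => ?_) hVd
  · exact real_inner_comm (V y) (V x)
  · refine (real_inner_self_pos (x := V x)).2 fun h => hx ?_
    refine eq_zero_of_observable hmin hr.ge fun t ht => ?_
    rw [← hGt t ht]
    have h1 := hV x ⟨_, hmem t ht⟩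
    rw [h] at h1
    exact h1.symm.trans (by simp)

end Necessity

end QuatKYP

theorem theorem4p1 (n N : ℕ)
    (A : Matrix (Fin N) (Fin N) ℍ[ℝ]) (B : Matrix (Fin N) (Fin n) ℍ[ℝ])
    (C : Matrix (Fin n) (Fin N) ℍ[ℝ]) (D : Matrix (Fin n) (Fin n) ℍ[ℝ])
    (φ : ℍ[ℝ] → Matrix (Fin n) (Fin n) ℍ[ℝ])
    (hφ : QuatKYP.IsRealization φ A B C D) (hmin : QuatKYP.IsMinimal C A B) :
    List.TFAE [
      QuatKYP.halfSpace ⊆ QuatKYP.starResolventSet A ∧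
        QuatKYP.PosDefKernelOn (QuatKYP.kernel φ) QuatKYP.halfSpace,
      QuatKYP.PosDefKernelOn (QuatKYP.kernel φ)
        (QuatKYP.halfSpace ∩ QuatKYP.starResolventSet A),
      ∃ H : Matrix (Fin N) (Fin N) ℍ[ℝ], QuatKYP.NegDef H ∧
        QuatKYP.PosSemidef
          (Matrix.fromBlocks H 0 0 1 * Matrix.fromBlocks A B C D +
            (Matrix.fromBlocks A B C D)ᴴ * Matrix.fromBlocks H 0 0 1)] := by
  tfae_have 1 → 2
  | ⟨_, hherm, hpos⟩ => ⟨fun p hp q hq => hherm p hp.1 q hq.1,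
      fun m u ξ hu => hpos m u ξ fun k => (hu k).1⟩
  tfae_have 2 → 3 := QuatKYP.exists_negDef_of_posDefKernelOn hφ hmin
  tfae_have 3 → 1
  | ⟨_, hH, hblock⟩ => QuatKYP.posDefKernelOn_of_dissipative hφ hH hblock
  tfae_finish
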